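/- Let $D\subset\mathbb R^2$ be a nonempty bounded connected open set, let $g$ be a positive continuous function on $\partial D$, let $0<\lambda<\Lambda$, and let $f:\mathbb R^2\to\mathbb R$ be continuous with $\lambda<f<\Lambda$. For $v:\mathbb R^2\setminus D\to[0,\infty)$ put $\Omega(v)=\{x\in\mathbb R^2\setminus D: v(x)>0\}$, and let $\partial\Omega(v)$ be the boundary of $\Omega(v)$ relative to $\mathbb R^2\setminus D$. Consider the one-phase problem $$\Delta u=0\ \text{in }\Omega(u)\setminus D,\qquad u=g\ \text{on }\partial D,\qquad |\nabla u|^2=f\ \text{on }\partial\Omega(u).$$ A continuous $v:\mathbb R^2\setminus D\to[0,\infty)$ is a (viscosity) subsolution if: (1) $\Delta v\ge0$ in the viscosity sense in $\Omega(v)\setminus\overline D$; (2) $v\le g$ on $\partial D$; (3) whenever $x_0\in\partial\Omega(v)\cap\partial B_\rho(y)$ for a ball with $B_\rho(y)\cap\Omega(v)=\emptyset$, and $v(x)\le\alpha\langle x-x_0,\nu\rangle^++o(|x-x_0|)$ as $x\to x_0$, $x\notin D$, with $\nu=(x_0-y)/\rho$, then $\alpha\ge\sqrt{f(x_0)}$.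 Let $p\in D$, $D\subset B_r(p)$, $G\ge\max_{\partial D}g$, and let $$h(x)=G\Big(\frac{\ln(|x-p|/R_0)}{\ln(r/R_0)}\Big)_+,\qquad R_0=\inf\Big\{R>r:\ \frac{G^2}{R^2\ln^2(r/R)}<\lambda\Big\}.$$ Let $u=\sup\{v: v \text{ is a subsolution and } v\le h\}$ be the largest subsolution. Then there are an absolute constant $C>0$ and a constant $K>0$ depending only on $D,g,\lambda,\Lambda$ such that: (a) $u(x)\le K\,\mathrm{dist}(x,\partial\Omega(u))$ for every $x\in\Omega(u)$. (b) $u(x)\le C\sqrt\Lambda\,\mathrm{dist}(x,\partial\Omega(u))$ for every $x\in\Omega(u)$ with $\mathrm{dist}(x,\partial\Omega(u))\le\mathrm{dist}(x,D)$. (c) $u$ is differentiable in $\Omega(u)\setminus\overline D$, and $|\nabla u(x)|\le C\sqrt\Lambda$ for every $x\in\Omega(u)\setminus\overline D$ with $\mathrm{dist}(x,\partial\Omega(u))\le\mathrm{dist}(x,D)$. (d) $u$ is Lipschitz away from $D$: for every $\delta>0$ it is Lipschitz on $\{x:\mathrm{dist}(x,D)\ge\delta\}$ with constant $C\max(\sqrt\Lambda,\,G/\delta)$.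 -/

import Mathlib

open Set Filter Topology Metric
open scoped RealInnerProductSpace

noncomputable section

namespace OnePhase

/-- The Euclidean plane. -/
abbrev Plane : Type := EuclideanSpace ℝ (Fin 2)

/-- The positivity set `Ω(u) = {u > 0}` of a function on `ℝ² \ D`. Functions on `ℝ² \ D` are
written as functions on the plane; their values in `D` are never used. -/
def posSet (D : Set Plane) (u : Plane → ℝ) : Set Plane :=
  {x | x ∉ D ∧ 0 < u x}

/-- The free boundary `∂Ω(u)`: the boundary of `Ω(u)` relative to the closed set `ℝ² \ D` on
which `u` lives. Points of `∂D` at which `u` is positive do not belong to it. -/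
def freeBoundary (D : Set Plane) (u : Plane → ℝ) : Set Plane :=
  Dᶜ ∩ closure (posSet D u) ∩ closure (Dᶜ \ posSet D u)

/-- `Δ u ≥ 0` in `Ω(u) \ D` in the viscosity sense: `C²` functions touching `u` from above at an
interior point have non-negative Laplacian there. The interior of `ℝ² \ D` is `(closure D)ᶜ`. -/
def ViscositySubharmonic (D : Set Plane) (u : Plane → ℝ) : Prop :=
  ∀ x₀ ∈ posSet D u, x₀ ∉ closure D → ∀ φ : Plane → ℝ, ContDiffAt ℝ 2 φ x₀ →
    IsLocalMax (fun x => u x - φ x) x₀ → 0 ≤ Laplacian.laplacian φ x₀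

/-- The subsolution part of `|∇u|² = f` on `∂Ω(u)`. If `B_ρ(y)` lies outside `Ω(u)` and touches
`∂Ω(u)` at `x₀`, the unit normal at `x₀` pointing into `Ω(u)` is `ν = (x₀ - y) / ρ`; whenever
`u(x) ≤ α ⟨x - x₀, ν⟩⁺ + o(|x - x₀|)` near `x₀`, one has `α ≥ √(f x₀)`. -/
def SubFreeBoundaryCondition (D : Set Plane) (f u : Plane → ℝ) : Prop :=
  ∀ x₀ ∈ freeBoundary D u, ∀ (y : Plane) (ρ : ℝ), 0 < ρ →
    Disjoint (ball y ρ) (posSet D u) → x₀ ∈ sphere y ρ →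
    ∀ α : ℝ,
      (∀ ε : ℝ, 0 < ε → ∀ᶠ x in 𝓝[Dᶜ] x₀,
        u x ≤ α * max ⟪x - x₀, ρ⁻¹ • (x₀ - y)⟫ 0 + ε * ‖x - x₀‖) →
      √(f x₀) ≤ α

/-- Viscosity subsolutions `v : ℝ² \ D → [0, ∞)` of the one-phase problem
`Δu = 0` in `Ω(u) \ D`, `u = g` on `∂D`, `|∇u|² = f` on `∂Ω(u)`. -/
structure IsSubsolution (D : Set Plane) (f g v : Plane → ℝ) : Prop where
  continuousOn : ContinuousOn v Dᶜ
  nonneg : ∀ x ∉ D, 0 ≤ v x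
  subharmonic : ViscositySubharmonic D v
  le_boundary : ∀ x ∈ frontier D, v x ≤ g x
  free_boundary : SubFreeBoundaryCondition D f v

/-- The radius `R₀ > r` at which the logarithmic supersolution with value `G` on `∂B_r` and
zero set outside `B_{R₀}` has squared slope `lam`. -/
def outerRadius (lam r G : ℝ) : ℝ :=
  sInf {R : ℝ | r < R ∧ G ^ 2 / (R ^ 2 * Real.log (r / R) ^ 2) < lam}

/-- The radial logarithmic supersolution around `p`, equal to `G` on `∂B_r(p)`. -/
def logSupersolution (lam : ℝ) (p : Plane) (r G : ℝ) (x : Plane) : ℝ :=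
  max (G * (Real.log (dist x p / outerRadius lam r G) / Real.log (r / outerRadius lam r G))) 0

/-- The largest subsolution: the pointwise supremum of all subsolutions below `h`. -/
def largestSubsolution (D : Set Plane) (f g h : Plane → ℝ) (x : Plane) : ℝ :=
  sSup {t : ℝ | ∃ v : Plane → ℝ, IsSubsolution D f g v ∧ (∀ y ∉ D, v y ≤ h y) ∧ v x = t}

end OnePhase

end

/-!
The pointwise maximum and the harmonic replacement of subsolutions are again subsolutions, so by
Perron's method the largest subsolution `u` is harmonic in `Ω(u) \ closure D`.

Near `D` it is bounded below by a barrier. Since `D` is connected and contains two distant points,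
`√((z - b) / (z - a))` with `a`, `b` in `D` has a single-valued branch off `D`, and so does the
inverse Joukowski map with foci `a`, `b`. The logarithm of its modulus is harmonic, with slope of
order `1 / ε` at the scale `ε = |a - b|`; when `ε` is small, a fixed multiple of it, cut off at
zero, is a subsolution. Hence `u` is positive in a neighbourhood of `D` that does not depend on `f`,
which reduces (a) to (b).

The core is (b). If `u(x)` were large compared with `√Λ d`, where `d = dist(x, ∂Ω(u))` is at most
`dist(x, D)`, then by Harnack's inequality `u` would lie on a small ball about `x` above a radial
logarithm whose zero circle is slightly larger than `∂B_d(x)` and carries slope at least `√Λ`. The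
maximum of this logarithm and `u` is a larger subsolution, and it is positive at the points of
`∂Ω(u)` on `∂B_d(x)`, a contradiction. Interior gradient estimates for positive harmonic functions
then give (c), and integrating the gradient bound along segments gives (d).
-/

noncomputable section

namespace OnePhase

open InnerProductSpace Laplacian

/-! ### Planar harmonic functions -/

section LocalMax

lemma deriv_deriv_nonpos_of_isLocalMax {γ : ℝ → ℝ} {a : ℝ} (hc : ContinuousAt γ a)
    (hmax : IsLocalMax γ a) : deriv (deriv γ) a ≤ 0 := by
  by_contra! hpos
  have hmin : IsLocalMin γ a := isLocalMin_of_deriv_deriv_pos hpos hmax.deriv_eq_zero hc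
  have hconst : γ =ᶠ[𝓝 a] fun _ => γ a := by
    filter_upwards [hmax, hmin] with t h₁ h₂ using le_antisymm h₁ h₂
  have hzero : deriv γ =ᶠ[𝓝 a] fun _ => 0 := by
    filter_upwards [hconst.deriv] with t ht
    rw [ht, deriv_const]
  rw [hzero.deriv_eq, deriv_const] at hpos
  exact lt_irrefl _ hpos

variable {E : Type*} [NormedAddCommGroup E]

lemma fderiv_fderiv_apply_nonpos_of_isLocalMax [NormedSpace ℝ E] {φ : E → ℝ} {x : E}
    (hφ : ContDiffAt ℝ 2 φ x) (hmax : IsLocalMax φ x) (v : E) :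
    fderiv ℝ (fderiv ℝ φ) x v v ≤ 0 := by
  set γ : ℝ → E := fun t => x + t • v with hγ_def
  have hγ0 : γ 0 = x := by simp [hγ_def]
  have hγ : ∀ t, HasDerivAt γ v t := fun t => by
    simpa only [one_smul, id] using ((hasDerivAt_id t).smul_const v).const_add x
  have hlim : Tendsto γ (𝓝 0) (𝓝 x) := hγ0 ▸ (hγ 0).continuousAt.tendsto
  have hderiv : deriv (φ ∘ γ) =ᶠ[𝓝 0] fun t => fderiv ℝ φ (γ t) v := by
    filter_upwards [hlim.eventually (hφ.eventually (by simp))] with t ht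
    exact ((ht.differentiableAt (by simp)).hasFDerivAt.comp_hasDerivAt t (hγ t)).deriv
  have hsecond : HasDerivAt (fun t => fderiv ℝ φ (γ t) v) (fderiv ℝ (fderiv ℝ φ) x v v) 0 := by
    have h : HasFDerivAt (fderiv ℝ φ) (fderiv ℝ (fderiv ℝ φ) x) (γ 0) := by
      rw [hγ0]
      exact ((hφ.fderiv_right (m := 1) (by norm_num)).differentiableAt (by simp)).hasFDerivAt
    simpa using (h.comp_hasDerivAt 0 (hγ 0)).clm_apply (hasDerivAt_const 0 v)
  rw [← hsecond.deriv, ← hderiv.deriv_eq]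
  refine deriv_deriv_nonpos_of_isLocalMax ?_ ?_
  · exact ContinuousAt.comp (hγ0.symm ▸ hφ.continuousAt) (hγ 0).continuousAt
  · simpa only [IsLocalMax, IsMaxFilter, Function.comp_apply, hγ0] using hlim.eventually hmax

variable [InnerProductSpace ℝ E] [FiniteDimensional ℝ E]

lemma laplacian_nonpos_of_isLocalMax {φ : E → ℝ} {x : E} (hφ : ContDiffAt ℝ 2 φ x)
    (hmax : IsLocalMax φ x) : Δ φ x ≤ 0 := by
  rw [laplacian_eq_iteratedFDeriv_stdOrthonormalBasis]
  refine Finset.sum_nonpos fun i _ => ?_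
  rw [iteratedFDeriv_two_apply]
  exact fderiv_fderiv_apply_nonpos_of_isLocalMax hφ hmax _

lemma laplacian_norm_sq (x : E) :
    Δ (fun y : E => ‖y‖ ^ 2) x = 2 * Module.finrank ℝ E := by
  have hfirst : fderiv ℝ (fun y : E => ‖y‖ ^ 2) = ⇑((2 : ℕ) • innerSL ℝ (E := E)) := by
    ext1 y
    exact (hasStrictFDerivAt_norm_sq y).hasFDerivAt.fderiv
  have hterm : ∀ v : E, ‖v‖ = 1 → iteratedFDeriv ℝ 2 (fun y : E => ‖y‖ ^ 2) x ![v, v] = 2 := by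
    intro v hv
    rw [iteratedFDeriv_two_apply, hfirst, ContinuousLinearMap.fderiv]
    change (2 : ℕ) • innerSL ℝ v v = 2
    rw [innerSL_apply_apply, real_inner_self_eq_norm_sq, hv, one_pow, nsmul_one, Nat.cast_ofNat]
  rw [laplacian_eq_iteratedFDeriv_stdOrthonormalBasis]
  simp only [hterm _ ((stdOrthonormalBasis ℝ E).norm_eq_one _), Finset.sum_const,
    Finset.card_univ, Fintype.card_fin, nsmul_eq_mul, mul_comm]

end LocalMax

section Isometry

variable {E F : Type*} [NormedAddCommGroup E] [InnerProductSpace ℝ E] [FiniteDimensional ℝ E]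
  [NormedAddCommGroup F] [InnerProductSpace ℝ F] [FiniteDimensional ℝ F]

lemma laplacian_comp_linearIsometryEquiv (e : E ≃ₗᵢ[ℝ] F) (f : F → ℝ) (x : E) :
    Δ (f ∘ e) x = Δ f (e x) := by
  rw [laplacian_eq_iteratedFDeriv_orthonormalBasis _ (stdOrthonormalBasis ℝ E),
    laplacian_eq_iteratedFDeriv_orthonormalBasis _ ((stdOrthonormalBasis ℝ E).map e)]
  refine Finset.sum_congr rfl fun i _ => ?_
  have h := e.toContinuousLinearEquiv.iteratedFDerivWithin_comp_right (𝕜 := ℝ) f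
    uniqueDiffOn_univ (mem_univ (e x)) 2
  simp only [preimage_univ, iteratedFDerivWithin_univ] at h
  change iteratedFDeriv ℝ 2 (f ∘ e.toContinuousLinearEquiv) x _ = _
  rw [h, ContinuousMultilinearMap.compContinuousLinearMap_apply]
  congr 1
  ext j
  fin_cases j <;> simp

lemma laplacian_comp_affineIsometryEquiv (e : E ≃ᵃⁱ[ℝ] F) (f : F → ℝ) (x : E) :
    Δ (f ∘ e) x = Δ f (e x) := by
  have he : ∀ y, e y = e.linearIsometryEquiv y + e 0 := fun y => by
    simpa using e.map_vadd 0 y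
  have hcomp : f ∘ e = (fun z => f (z + e 0)) ∘ e.linearIsometryEquiv := by
    ext y
    rw [Function.comp_apply, he, Function.comp_apply]
  rw [hcomp, laplacian_comp_linearIsometryEquiv, he x,
    laplacian_eq_iteratedFDeriv_stdOrthonormalBasis,
    laplacian_eq_iteratedFDeriv_stdOrthonormalBasis]
  simp only [iteratedFDeriv_comp_add_right]

lemma harmonicAt_comp_affineIsometryEquiv (e : E ≃ᵃⁱ[ℝ] F) {f : F → ℝ} {x : E}
    (h : HarmonicAt f (e x)) : HarmonicAt (f ∘ e) x := by
  have he : ContDiff ℝ 2 e := e.toContinuousAffineEquiv.toContinuousAffineMap.contDiff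
  refine ⟨h.1.comp x he.contDiffAt, ?_⟩
  filter_upwards [e.continuous.continuousAt.eventually h.2] with y hy
  rw [laplacian_comp_affineIsometryEquiv, hy]
  rfl

/-- The isometric identification of the plane with `ℂ` that sends `c` to the origin. It carries
Mathlib's one-variable complex analysis over to discs centred at `c`. -/
def complexChart (c : Plane) : Plane ≃ᵃⁱ[ℝ] ℂ :=
  (AffineIsometryEquiv.vaddConst ℝ c).symm.trans
    Complex.orthonormalBasisOneI.repr.symm.toAffineIsometryEquiv

lemma norm_complexChart (c x : Plane) : ‖complexChart c x‖ = dist x c := by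
  have hc : complexChart c c = 0 := by simp [complexChart]
  rw [← dist_zero_right, ← hc, AffineIsometryEquiv.dist_map]

lemma dist_complexChart_symm (c : Plane) (z : ℂ) : dist ((complexChart c).symm z) c = ‖z‖ := by
  rw [← norm_complexChart, AffineIsometryEquiv.apply_symm_apply]

lemma complexChart_symm_zero (c : Plane) : (complexChart c).symm 0 = c := by
  rw [← dist_eq_zero, dist_complexChart_symm, norm_zero]

lemma harmonicAt_log_dist {p x : Plane} (h : x ≠ p) :
    HarmonicAt (fun y => Real.log (dist y p)) x := by
  have hx : complexChart p x ≠ 0 := by rwa [← norm_ne_zero_iff, norm_complexChart, dist_ne_zero]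
  have hlog : HarmonicAt (fun z : ℂ => Real.log ‖z‖) (complexChart p x) :=
    analyticAt_id.harmonicAt_log_norm hx
  simpa only [Function.comp_def, norm_complexChart] using
    harmonicAt_comp_affineIsometryEquiv (complexChart p) hlog

end Isometry

section PoissonIntegral

open Real

variable {R : ℝ} {φ ψ : ℂ → ℝ} {w z ζ : ℂ}

/-- The Poisson integral of `φ` over the circle of radius `R` about the origin, evaluated
at `w`. -/
def poissonIntegral (R : ℝ) (φ : ℂ → ℝ) (w : ℂ) : ℝ :=
  circleAverage (poissonKernel 0 w • φ) 0 R

lemma continuousOn_poissonKernel (hw : w ∈ ball (0 : ℂ) R) :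
    ContinuousOn (poissonKernel 0 w) (sphere 0 |R|) := by
  rw [poissonKernel_eq_re_herglotzRieszKernel]
  exact Complex.continuous_re.comp_continuousOn (continuousOn_herglotzRieszKernel_sphere hw)

lemma circleIntegrable_poissonKernel_smul (hφ : CircleIntegrable φ 0 R)
    (hw : w ∈ ball (0 : ℂ) R) : CircleIntegrable (poissonKernel 0 w • φ) 0 R :=
  hφ.continuousOn_smul (continuousOn_poissonKernel hw)

lemma harmonicOnNhd_poissonIntegral (hφ : CircleIntegrable φ 0 R) :
    HarmonicOnNhd (poissonIntegral R φ) (ball 0 R) := by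
  intro w hw
  have hφc : CircleIntegrable (fun ζ => (φ ζ : ℂ)) 0 R := by
    simp only [CircleIntegrable, intervalIntegrable_iff] at hφ ⊢
    exact Complex.ofRealCLM.integrable_comp hφ
  refine (harmonicAt_congr_nhds ?_).1
    (analyticOnNhd_circleAverage_herglotzRieszKernel_smul hφc w hw).harmonicAt_re
  filter_upwards [isOpen_ball.mem_nhds hw] with y hy
  rw [re_circleAverage_herglotzRieszKernel_smul hφ hy, poissonIntegral,
    poissonKernel_eq_re_herglotzRieszKernel]

lemma le_poissonKernel (hw : w ∈ ball (0 : ℂ) R) (hz : z ∈ sphere (0 : ℂ) R) :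
    (R - ‖w‖) / (R + ‖w‖) ≤ poissonKernel 0 w z := by
  rw [poissonKernel_eq_re_herglotzRieszKernel]
  simpa [herglotzRieszKernel_def] using le_re_herglotzRieszKernel hz hw

lemma poissonKernel_le (hw : w ∈ ball (0 : ℂ) R) (hz : z ∈ sphere (0 : ℂ) R) :
    poissonKernel 0 w z ≤ (R + ‖w‖) / (R - ‖w‖) := by
  rw [poissonKernel_eq_re_herglotzRieszKernel]
  simpa [herglotzRieszKernel_def] using re_herglotzRieszKernel_le hz hw

lemma poissonKernel_nonneg (hw : w ∈ ball (0 : ℂ) R) (hz : z ∈ sphere (0 : ℂ) R) :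
    0 ≤ poissonKernel 0 w z := by
  have hwR : ‖w‖ < R := by simpa using hw
  exact (div_nonneg (sub_nonneg.2 hwR.le) (by linarith [norm_nonneg w])).trans
    (le_poissonKernel hw hz)

lemma poissonKernel_le_of_le_dist {η : ℝ} (hη : 0 < η) (hw : w ∈ ball (0 : ℂ) R)
    (hz : z ∈ sphere (0 : ℂ) R) (hzw : η ≤ dist z w) :
    poissonKernel 0 w z ≤ (R ^ 2 - ‖w‖ ^ 2) / η ^ 2 := by
  have hwR : ‖w‖ < R := by simpa using hw
  have hzR : ‖z‖ = R := by simpa using hz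
  rw [dist_eq_norm] at hzw
  rw [poissonKernel_def, sub_zero, sub_zero, hzR]
  have : ‖w‖ ^ 2 ≤ R ^ 2 := by gcongr
  gcongr

lemma poissonIntegral_const (hw : w ∈ ball (0 : ℂ) R) (a : ℝ) :
    poissonIntegral R (fun _ => a) w = a :=
  HarmonicOnNhd.circleAverage_poissonKernel_smul (f := fun _ => a) (harmonicOnNhd_const a) hw

lemma poissonIntegral_sub (hw : w ∈ ball (0 : ℂ) R) (hφ : CircleIntegrable φ 0 R)
    (hψ : CircleIntegrable ψ 0 R) :
    poissonIntegral R (φ - ψ) w = poissonIntegral R φ w - poissonIntegral R ψ w := by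
  rw [poissonIntegral, poissonIntegral, poissonIntegral, smul_sub,
    circleAverage_sub (circleIntegrable_poissonKernel_smul hφ hw)
      (circleIntegrable_poissonKernel_smul hψ hw)]

lemma poissonKernel_mul_abs_sub_le {ε δ M : ℝ} (hε : 0 ≤ ε) (hδ : 0 < δ)
    (hM : ∀ z ∈ sphere (0 : ℂ) R, |φ z| ≤ M) (hζ : ζ ∈ sphere (0 : ℂ) R)
    (hc : ∀ z ∈ sphere (0 : ℂ) R, dist z ζ < δ → |φ z - φ ζ| ≤ ε)
    (hw : w ∈ ball (0 : ℂ) R) (hwζ : dist w ζ < δ / 2) (hz : z ∈ sphere (0 : ℂ) R) :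
    poissonKernel 0 w z * |φ z - φ ζ| ≤
      poissonKernel 0 w z * ε + 2 * M * ((R ^ 2 - ‖w‖ ^ 2) / (δ / 2) ^ 2) := by
  have hP := poissonKernel_nonneg hw hz
  have hM0 : 0 ≤ M := (abs_nonneg _).trans (hM ζ hζ)
  have hfar : 0 ≤ (R ^ 2 - ‖w‖ ^ 2) / (δ / 2) ^ 2 := by
    have hwR : ‖w‖ < R := by simpa using hw
    have : ‖w‖ ^ 2 ≤ R ^ 2 := by gcongr
    exact div_nonneg (sub_nonneg.2 this) (by positivity)
  rcases lt_or_ge (dist z ζ) δ with hzζ | hzζ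
  · exact (mul_le_mul_of_nonneg_left (hc z hz hzζ) hP).trans
      (le_add_of_nonneg_right (by positivity))
  · have hdiff : |φ z - φ ζ| ≤ 2 * M := by
      linarith [abs_sub (φ z) (φ ζ), hM z hz, hM ζ hζ]
    have hzw : δ / 2 ≤ dist z w := by linarith [dist_triangle z w ζ]
    calc poissonKernel 0 w z * |φ z - φ ζ|
        ≤ (R ^ 2 - ‖w‖ ^ 2) / (δ / 2) ^ 2 * (2 * M) :=
          mul_le_mul (poissonKernel_le_of_le_dist (half_pos hδ) hw hz hzw) hdiff
            (abs_nonneg _) hfar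
      _ ≤ _ := by linarith [mul_nonneg hP hε]

lemma abs_poissonIntegral_sub_le {ε δ M : ℝ} (hφ : CircleIntegrable φ 0 R) (hε : 0 ≤ ε)
    (hδ : 0 < δ) (hM : ∀ z ∈ sphere (0 : ℂ) R, |φ z| ≤ M) (hζ : ζ ∈ sphere (0 : ℂ) R)
    (hc : ∀ z ∈ sphere (0 : ℂ) R, dist z ζ < δ → |φ z - φ ζ| ≤ ε)
    (hw : w ∈ ball (0 : ℂ) R) (hwζ : dist w ζ < δ / 2) :
    |poissonIntegral R φ w - φ ζ| ≤ ε + 2 * M * ((R ^ 2 - ‖w‖ ^ 2) / (δ / 2) ^ 2) := by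
  have hconst : ∀ a : ℝ, CircleIntegrable (fun _ : ℂ => a) 0 R := fun _ =>
    circleIntegrable_const _ _ _
  have hnear := circleIntegrable_poissonKernel_smul (hconst ε) hw
  calc |poissonIntegral R φ w - φ ζ|
      = |poissonIntegral R (φ - fun _ => φ ζ) w| := by
        rw [poissonIntegral_sub hw hφ (hconst _), poissonIntegral_const hw]
    _ ≤ circleAverage |poissonKernel 0 w • (φ - fun _ => φ ζ)| 0 R :=
        abs_circleAverage_le_circleAverage_abs
    _ ≤ circleAverage (poissonKernel 0 w • (fun _ : ℂ => ε) +
          fun _ => 2 * M * ((R ^ 2 - ‖w‖ ^ 2) / (δ / 2) ^ 2)) 0 R := by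
        refine circleAverage_mono (circleIntegrable_poissonKernel_smul (hφ.sub (hconst _)) hw).abs
          (hnear.add (hconst _)) fun z hz => ?_
        rw [abs_of_pos (pos_of_mem_ball hw)] at hz
        change |poissonKernel 0 w z * (φ z - φ ζ)| ≤ _
        rw [abs_mul, abs_of_nonneg (poissonKernel_nonneg hw hz)]
        exact poissonKernel_mul_abs_sub_le hε hδ hM hζ hc hw hwζ hz
    _ = ε + 2 * M * ((R ^ 2 - ‖w‖ ^ 2) / (δ / 2) ^ 2) := by
        rw [circleAverage_add hnear (hconst _), circleAverage_const]
        congr 1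
        exact poissonIntegral_const hw ε

lemma tendsto_poissonIntegral_sphere (hφ : ContinuousOn φ (sphere 0 R))
    (hζ : ζ ∈ sphere (0 : ℂ) R) :
    Tendsto (poissonIntegral R φ) (𝓝[ball 0 R] ζ) (𝓝 (φ ζ)) := by
  have hζR : ‖ζ‖ = R := by simpa using hζ
  have hcircle : CircleIntegrable φ 0 R := hφ.circleIntegrable (hζR ▸ norm_nonneg ζ)
  obtain ⟨M, hM⟩ := (isCompact_sphere (0 : ℂ) R).exists_bound_of_continuousOn hφ
  simp only [Real.norm_eq_abs] at hM
  rw [Metric.tendsto_nhds]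
  intro ε hε
  obtain ⟨δ, hδ, hc⟩ := Metric.continuousOn_iff.1 hφ ζ hζ (ε / 2) (half_pos hε)
  have hlim : Tendsto (fun w : ℂ => ε / 2 + 2 * M * ((R ^ 2 - ‖w‖ ^ 2) / (δ / 2) ^ 2)) (𝓝 ζ)
      (𝓝 (ε / 2)) := by
    have hcont : Continuous fun w : ℂ =>
      ε / 2 + 2 * M * ((R ^ 2 - ‖w‖ ^ 2) / (δ / 2) ^ 2) := by fun_prop
    simpa [hζR] using hcont.tendsto ζ
  filter_upwards [nhdsWithin_le_nhds (hlim.eventually (gt_mem_nhds (half_lt_self hε))),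
    self_mem_nhdsWithin, nhdsWithin_le_nhds (ball_mem_nhds ζ (half_pos hδ))] with w hbound hw hwζ
  exact (abs_poissonIntegral_sub_le hcircle (half_pos hε).le hδ hM hζ
    (fun z hz hzd => (hc z hz hzd).le) hw hwζ).trans_lt hbound

lemma exists_harmonic_extension_complex (hφ : ContinuousOn φ (sphere 0 R)) (hR : 0 < R) :
    ∃ H : ℂ → ℝ, ContinuousOn H (closedBall 0 R) ∧ HarmonicOnNhd H (ball 0 R) ∧
      EqOn H φ (sphere 0 R) := by
  classical
  have hdisj : Disjoint (ball (0 : ℂ) R) (sphere 0 R) := sphere_disjoint_ball.symm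
  set H : ℂ → ℝ := (ball 0 R).piecewise (poissonIntegral R φ) φ
  have hball : EqOn H (poissonIntegral R φ) (ball 0 R) := fun w => piecewise_eq_of_mem _ _ _
  have hsphere : EqOn H φ (sphere 0 R) := fun w hw =>
    piecewise_eq_of_notMem _ _ _ fun h => hdisj.ne_of_mem h hw rfl
  have hharm : HarmonicOnNhd H (ball 0 R) := fun w hw =>
    (harmonicAt_congr_nhds (hball.eventuallyEq_of_mem (isOpen_ball.mem_nhds hw))).2
      (harmonicOnNhd_poissonIntegral (hφ.circleIntegrable hR.le) w hw)
  refine ⟨H, fun ζ hζ => ?_, hharm, hsphere⟩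
  rcases ball_union_sphere (x := (0 : ℂ)) (ε := R) ▸ hζ with hζ | hζ
  · exact (hharm ζ hζ).1.continuousAt.continuousWithinAt
  · rw [← ball_union_sphere, continuousWithinAt_union, ContinuousWithinAt, ContinuousWithinAt,
      hsphere hζ]
    exact ⟨(tendsto_poissonIntegral_sphere hφ hζ).congr' <|
        eventually_nhdsWithin_of_forall fun w hw => (hball hw).symm,
      (hφ ζ hζ).congr' <| eventually_nhdsWithin_of_forall fun w hw => (hsphere hw).symm⟩

section Limit

variable {M : ℝ} {H : ℕ → ℂ → ℝ} {V : ℂ → ℝ}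

lemma circleIntegrable_of_tendsto (hH : ∀ n, ContinuousOn (H n) (sphere 0 |R|))
    (hM : ∀ n, ∀ z ∈ sphere (0 : ℂ) |R|, |H n z| ≤ M)
    (hlim : ∀ z ∈ sphere (0 : ℂ) |R|, Tendsto (fun n => H n z) atTop (𝓝 (V z))) :
    CircleIntegrable V 0 R := by
  have hcirc := circleMap_mem_sphere' 0 R
  have hmeas : Measurable fun θ => V (circleMap 0 R θ) :=
    measurable_of_tendsto_metrizable
      (fun n => ((hH n).comp_continuous (continuous_circleMap 0 R) hcirc).measurable)
      (tendsto_pi_nhds.2 fun θ => hlim _ (hcirc θ))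
  have hbound : IntervalIntegrable (fun _ : ℝ => M) MeasureTheory.volume 0 (2 * π) :=
    intervalIntegrable_const
  refine hbound.mono_fun hmeas.aestronglyMeasurable (Eventually.of_forall fun θ => ?_)
  exact (le_of_tendsto (hlim _ (hcirc θ)).abs
    (Eventually.of_forall fun n => hM n _ (hcirc θ))).trans (le_abs_self M)

lemma tendsto_poissonIntegral (hH : ∀ n, ContinuousOn (H n) (sphere 0 |R|))
    (hM : ∀ n, ∀ z ∈ sphere (0 : ℂ) |R|, |H n z| ≤ M)
    (hlim : ∀ z ∈ sphere (0 : ℂ) |R|, Tendsto (fun n => H n z) atTop (𝓝 (V z)))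
    (hw : w ∈ ball (0 : ℂ) R) :
    Tendsto (fun n => poissonIntegral R (H n) w) atTop (𝓝 (poissonIntegral R V w)) := by
  have hcirc := circleMap_mem_sphere' 0 R
  have hK : Continuous fun θ => poissonKernel 0 w (circleMap 0 R θ) :=
    (continuousOn_poissonKernel hw).comp_continuous (continuous_circleMap 0 R) hcirc
  unfold poissonIntegral circleAverage
  refine (intervalIntegral.tendsto_integral_filter_of_dominated_convergence
    (fun θ => |poissonKernel 0 w (circleMap 0 R θ)| * M) (Eventually.of_forall fun n => ?_)
    (Eventually.of_forall fun n => Eventually.of_forall fun θ _ => ?_)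
    ((hK.abs.mul continuous_const).intervalIntegrable _ _)
    (Eventually.of_forall fun θ _ => (hlim _ (hcirc θ)).const_mul _)).const_smul _
  · exact (hK.smul ((hH n).comp_continuous (continuous_circleMap 0 R)
      hcirc)).aestronglyMeasurable
  · rw [norm_mul, Real.norm_eq_abs, Real.norm_eq_abs]
    exact mul_le_mul_of_nonneg_left (hM n _ (hcirc θ)) (abs_nonneg _)

lemma harmonicOnNhd_of_tendsto_complex (hH : ∀ n, HarmonicOnNhd (H n) (ball 0 R))
    (hM : ∀ n, ∀ z ∈ ball (0 : ℂ) R, |H n z| ≤ M)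
    (hlim : ∀ z ∈ ball (0 : ℂ) R, Tendsto (fun n => H n z) atTop (𝓝 (V z))) :
    HarmonicOnNhd V (ball 0 R) := by
  intro w hw
  obtain ⟨s, hws, hsR⟩ := exists_between (mem_ball_zero_iff.1 hw)
  have hs : 0 < s := (norm_nonneg w).trans_lt hws
  have hclosed : closedBall (0 : ℂ) s ⊆ ball 0 R := closedBall_subset_ball hsR
  have hsphere : sphere (0 : ℂ) |s| ⊆ ball 0 R := by
    rw [abs_of_pos hs]
    exact sphere_subset_closedBall.trans hclosed
  have hcont := fun n => (hH n).continuousOn.mono hsphere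
  have hV : CircleIntegrable V 0 s := circleIntegrable_of_tendsto hcont
    (fun n z hz => hM n z (hsphere hz)) fun z hz => hlim z (hsphere hz)
  have hrep : EqOn V (poissonIntegral s V) (ball 0 s) := fun y hy =>
    tendsto_nhds_unique (hlim y (ball_subset_ball hsR.le hy)) <|
      (tendsto_poissonIntegral hcont (fun n z hz => hM n z (hsphere hz))
        (fun z hz => hlim z (hsphere hz)) hy).congr fun n =>
          HarmonicOnNhd.circleAverage_poissonKernel_smul ((hH n).mono hclosed) hy
  have hws : w ∈ ball (0 : ℂ) s := by simpa using hws
  exact (harmonicAt_congr_nhds (hrep.eventuallyEq_of_mem (isOpen_ball.mem_nhds hws))).2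
    (harmonicOnNhd_poissonIntegral hV w hws)

end Limit

lemma harnack_complex {H : ℂ → ℝ} (hH : HarmonicOnNhd H (closedBall 0 R))
    (hnn : ∀ z ∈ closedBall (0 : ℂ) R, 0 ≤ H z) (hw : w ∈ ball (0 : ℂ) R) :
    (R - ‖w‖) / (R + ‖w‖) * H 0 ≤ H w ∧ H w ≤ (R + ‖w‖) / (R - ‖w‖) * H 0 := by
  have hR : 0 < R := pos_of_mem_ball hw
  have hcircle : CircleIntegrable H 0 R :=
    (hH.continuousOn.mono sphere_subset_closedBall).circleIntegrable hR.le
  have hmean : circleAverage H 0 R = H 0 :=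
    InnerProductSpace.HarmonicOnNhd.circleAverage_eq (by rwa [abs_of_pos hR])
  have hrep : circleAverage (poissonKernel 0 w • H) 0 R = H w :=
    HarmonicOnNhd.circleAverage_poissonKernel_smul hH hw
  have hK := circleIntegrable_poissonKernel_smul hcircle hw
  have hscale : ∀ a : ℝ, a * H 0 = circleAverage (a • H) 0 R := fun a => by
    rw [circleAverage_smul, hmean, smul_eq_mul]
  rw [hscale, hscale, ← hrep]
  constructor
  · refine circleAverage_mono hcircle.const_smul hK fun z hz => ?_
    rw [abs_of_pos hR] at hz
    exact mul_le_mul_of_nonneg_right (le_poissonKernel hw hz) (hnn z (sphere_subset_closedBall hz))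
  · refine circleAverage_mono hK hcircle.const_smul fun z hz => ?_
    rw [abs_of_pos hR] at hz
    exact mul_le_mul_of_nonneg_right (poissonKernel_le hw hz) (hnn z (sphere_subset_closedBall hz))

end PoissonIntegral

section PlanarDisc

variable {c x : Plane} {R d : ℝ}

theorem exists_harmonic_extension (hR : 0 < R) {φ : Plane → ℝ}
    (hφ : ContinuousOn φ (sphere c R)) :
    ∃ H : Plane → ℝ, ContinuousOn H (closedBall c R) ∧ HarmonicOnNhd H (ball c R) ∧
      EqOn H φ (sphere c R) := by
  obtain ⟨H, hcont, hharm, hsphere⟩ := exists_harmonic_extension_complex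
    (φ := φ ∘ (complexChart c).symm)
    (hφ.comp (complexChart c).symm.continuous.continuousOn fun z hz => by
      rwa [mem_sphere, dist_complexChart_symm, ← mem_sphere_zero_iff_norm]) hR
  refine ⟨H ∘ complexChart c,
    hcont.comp (complexChart c).continuous.continuousOn fun x hx => ?_,
    fun x hx => harmonicAt_comp_affineIsometryEquiv _ (hharm _ ?_), fun x hx => ?_⟩
  · rwa [mem_closedBall_zero_iff, norm_complexChart]
  · rwa [mem_ball_zero_iff, norm_complexChart]
  · rw [Function.comp_apply, hsphere (by rwa [mem_sphere_zero_iff_norm, norm_complexChart]),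
      Function.comp_apply, AffineIsometryEquiv.symm_apply_apply]

theorem harmonicOnNhd_of_tendsto {M : ℝ} {H : ℕ → Plane → ℝ} {V : Plane → ℝ}
    (hH : ∀ n, HarmonicOnNhd (H n) (ball c R)) (hM : ∀ n, ∀ z ∈ ball c R, |H n z| ≤ M)
    (hlim : ∀ z ∈ ball c R, Tendsto (fun n => H n z) atTop (𝓝 (V z))) :
    HarmonicOnNhd V (ball c R) := by
  have hmem : ∀ z ∈ ball (0 : ℂ) R, (complexChart c).symm z ∈ ball c R := fun z hz => by
    rwa [mem_ball, dist_complexChart_symm, ← mem_ball_zero_iff]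
  have hV := harmonicOnNhd_of_tendsto_complex
    (H := fun n => H n ∘ (complexChart c).symm) (V := V ∘ (complexChart c).symm)
    (fun n z hz => harmonicAt_comp_affineIsometryEquiv _ (hH n _ (hmem z hz)))
    (fun n z hz => hM n _ (hmem z hz)) (fun z hz => hlim _ (hmem z hz))
  intro x hx
  have hx' : complexChart c x ∈ ball (0 : ℂ) R := by rwa [mem_ball_zero_iff, norm_complexChart]
  simpa [Function.comp_def] using harmonicAt_comp_affineIsometryEquiv (complexChart c) (hV _ hx')

theorem harnack {H : Plane → ℝ} (hH : HarmonicOnNhd H (closedBall c R))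
    (hnn : ∀ z ∈ closedBall c R, 0 ≤ H z) (hx : x ∈ ball c R) :
    (R - dist x c) / (R + dist x c) * H c ≤ H x ∧
      H x ≤ (R + dist x c) / (R - dist x c) * H c := by
  have hmem : ∀ z ∈ closedBall (0 : ℂ) R, (complexChart c).symm z ∈ closedBall c R :=
    fun z hz => by rwa [mem_closedBall, dist_complexChart_symm, ← mem_closedBall_zero_iff]
  have h := harnack_complex (H := H ∘ (complexChart c).symm) (w := complexChart c x)
    (fun z hz => harmonicAt_comp_affineIsometryEquiv _ (hH _ (hmem z hz)))
    (fun z hz => hnn _ (hmem z hz)) (by rwa [mem_ball_zero_iff, norm_complexChart])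
  simpa only [norm_complexChart, Function.comp_apply, complexChart_symm_zero,
    AffineIsometryEquiv.symm_apply_apply] using h

lemma div_five_le_of_harmonic {H : Plane → ℝ} (hH : HarmonicOnNhd H (ball c d))
    (hnn : ∀ z ∈ ball c d, 0 ≤ H z) (hd : 0 < d) (hx : x ∈ closedBall c (d / 2)) :
    H c / 5 ≤ H x := by
  have hsub : closedBall c (3 / 4 * d) ⊆ ball c d := closedBall_subset_ball (by linarith)
  have hxd : dist x c ≤ d / 2 := hx
  have : 0 ≤ dist x c := dist_nonneg
  refine le_trans ?_ (harnack (hH.mono hsub) (fun z hz => hnn z (hsub hz))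
    (mem_ball.2 (by linarith))).1
  rw [div_eq_inv_mul]
  refine mul_le_mul_of_nonneg_right ?_ (hnn c (mem_ball_self hd))
  rw [le_div_iff₀ (by positivity)]
  linarith

theorem norm_fderiv_le_of_harmonic {H : Plane → ℝ} (hH : HarmonicOnNhd H (ball c d))
    (hnn : ∀ z ∈ ball c d, 0 ≤ H z) (hd : 0 < d) : ‖fderiv ℝ H c‖ ≤ 8 * H c / d := by
  have hHc := hnn c (mem_ball_self hd)
  refine norm_fderiv_le_of_lip' ℝ (by positivity) ?_
  have hsub : closedBall c (3 / 4 * d) ⊆ ball c d := closedBall_subset_ball (by linarith)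
  filter_upwards [ball_mem_nhds c (half_pos hd)] with y hy
  have hyd : dist y c < d / 2 := hy
  obtain ⟨hlower, hupper⟩ := harnack (hH.mono hsub) (fun z hz => hnn z (hsub hz)) (x := y)
    (mem_ball.2 (by linarith))
  rw [← dist_eq_norm y c, Real.norm_eq_abs, abs_le]
  set t := dist y c
  have ht : 0 ≤ t := dist_nonneg
  have hcancel : 8 * t / d * d = 8 * t := div_mul_cancel₀ _ hd.ne'
  have : 0 ≤ 8 * t / d := by positivity
  have hfactor_lower : 1 - 8 * t / d ≤ (3 / 4 * d - t) / (3 / 4 * d + t) := by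
    rw [le_div_iff₀ (by positivity)]
    nlinarith
  have hfactor_upper : (3 / 4 * d + t) / (3 / 4 * d - t) ≤ 1 + 8 * t / d := by
    rw [div_le_iff₀ (by linarith)]
    nlinarith
  have hbelow := (mul_le_mul_of_nonneg_right hfactor_lower hHc).trans hlower
  have habove := hupper.trans (mul_le_mul_of_nonneg_right hfactor_upper hHc)
  rw [show 8 * H c / d * t = 8 * t / d * H c by ring]
  constructor <;> linarith

end PlanarDisc

section Comparison

variable {E : Type*} [NormedAddCommGroup E] [InnerProductSpace ℝ E] [FiniteDimensional ℝ E]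
  {v w H : E → ℝ} {x : E}

/-- `Δ v ≥ 0` at the single point `x` in the viscosity sense: `C²` functions touching `v` from
above at `x` have non-negative Laplacian there. -/
def ViscositySubharmonicAt (v : E → ℝ) (x : E) : Prop :=
  ∀ φ : E → ℝ, ContDiffAt ℝ 2 φ x → IsLocalMax (fun y => v y - φ y) x → 0 ≤ Δ φ x

lemma ViscositySubharmonicAt.of_le (hw : ViscositySubharmonicAt w x) (hle : w ≤ᶠ[𝓝 x] v)
    (heq : w x = v x) : ViscositySubharmonicAt v x := by
  intro φ hφ hmax
  refine hw φ hφ ?_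
  filter_upwards [hmax, hle] with y hy hwv
  linarith

lemma laplacian_eq_zero_of_harmonicAt (hH : HarmonicAt H x) : Δ H x = 0 :=
  hH.2.self_of_nhds

lemma viscositySubharmonicAt_of_harmonicAt (hH : HarmonicAt H x) :
    ViscositySubharmonicAt H x := by
  intro φ hφ hmax
  have h : Δ (H - φ) x ≤ 0 := laplacian_nonpos_of_isLocalMax (hH.1.sub hφ) hmax
  rw [hH.1.laplacian_sub hφ, laplacian_eq_zero_of_harmonicAt hH] at h
  linarith

lemma not_isLocalMax_sub_of_harmonicAt [Nontrivial E] {ε : ℝ} (hε : 0 < ε) (hH : HarmonicAt H x)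
    (hv : ViscositySubharmonicAt v x) : ¬ IsLocalMax (fun y => v y - (H y - ε * ‖y‖ ^ 2)) x := by
  intro hmax
  have hnsq : ContDiffAt ℝ 2 (fun y : E => ‖y‖ ^ 2) x := (contDiff_norm_sq ℝ).contDiffAt
  have hεnsq : ContDiffAt ℝ 2 (ε • fun y : E => ‖y‖ ^ 2) x := hnsq.const_smul ε
  have hLap := hv (H - ε • fun y : E => ‖y‖ ^ 2) (hH.1.sub hεnsq) hmax
  rw [hH.1.laplacian_sub hεnsq, laplacian_smul ε hnsq, laplacian_norm_sq,
    laplacian_eq_zero_of_harmonicAt hH, smul_eq_mul] at hLap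
  have hdim : (0 : ℝ) < Module.finrank ℝ E := by exact_mod_cast Module.finrank_pos
  nlinarith [mul_pos hε hdim]

theorem le_of_viscositySubharmonicAt [Nontrivial E] {U : Set E} (hU : IsOpen U)
    (hb : Bornology.IsBounded U) (hv : ContinuousOn v (closure U))
    (hH : ContinuousOn H (closure U)) (hharm : HarmonicOnNhd H U)
    (hsub : ∀ x ∈ U, H x < v x → ViscositySubharmonicAt v x)
    (hbd : ∀ x ∈ frontier U, v x ≤ H x) : ∀ x ∈ closure U, v x ≤ H x := by
  by_contra! ⟨x₁, hx₁, hlt⟩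
  obtain ⟨B, hB⟩ := hb.closure.exists_norm_le
  -- Subtract from `H` a multiple of `‖x‖²` so small that the maximum of `v - H` stays positive.
  obtain ⟨ε, hε, hεB⟩ : ∃ ε > 0, ε * B ^ 2 < v x₁ - H x₁ := by
    have hden : 0 < B ^ 2 + 1 := by positivity
    refine ⟨(v x₁ - H x₁) / (B ^ 2 + 1), div_pos (sub_pos.2 hlt) hden, ?_⟩
    rw [div_mul_eq_mul_div, div_lt_iff₀ hden]
    linarith
  obtain ⟨x₀, hx₀, hmax⟩ := hb.isCompact_closure.exists_isMaxOn ⟨x₁, hx₁⟩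
    (f := fun x => v x - (H x - ε * ‖x‖ ^ 2)) (by fun_prop)
  have hpos : H x₀ < v x₀ := by
    have hx₁_le : v x₁ - (H x₁ - ε * ‖x₁‖ ^ 2) ≤ v x₀ - (H x₀ - ε * ‖x₀‖ ^ 2) := hmax hx₁
    have hx₀B : ε * ‖x₀‖ ^ 2 ≤ ε * B ^ 2 := by
      gcongr
      exact hB x₀ hx₀
    have : 0 ≤ ε * ‖x₁‖ ^ 2 := by positivity
    linarith
  have hx₀U : x₀ ∈ U := by
    by_contra hn
    exact hpos.not_ge (hbd x₀ ⟨hx₀, by rwa [hU.interior_eq]⟩)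
  refine not_isLocalMax_sub_of_harmonicAt hε (hharm x₀ hx₀U) (hsub x₀ hx₀U hpos) ?_
  filter_upwards [hU.mem_nhds hx₀U] with y hy using hmax (subset_closure hy)

end Comparison

/-! ### Perron's method -/

section FreeBoundary

variable {D : Set Plane} {f v w : Plane → ℝ} {x : Plane}

/-- The condition of `SubFreeBoundaryCondition` at the single point `x₀`. -/
def SubFreeBoundaryConditionAt (D : Set Plane) (f u : Plane → ℝ) (x₀ : Plane) : Prop :=
  ∀ (y : Plane) (ρ : ℝ), 0 < ρ → Disjoint (ball y ρ) (posSet D u) → x₀ ∈ sphere y ρ →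
    ∀ α : ℝ,
      (∀ ε : ℝ, 0 < ε → ∀ᶠ x in 𝓝[Dᶜ] x₀,
        u x ≤ α * max ⟪x - x₀, ρ⁻¹ • (x₀ - y)⟫ 0 + ε * ‖x - x₀‖) →
      √(f x₀) ≤ α

lemma posSet_mono (hle : ∀ x ∉ D, w x ≤ v x) : posSet D w ⊆ posSet D v :=
  fun x hx => ⟨hx.1, hx.2.trans_le (hle x hx.1)⟩

lemma SubFreeBoundaryConditionAt.of_le (hw : SubFreeBoundaryConditionAt D f w x)
    (hle : ∀ x ∉ D, w x ≤ v x) : SubFreeBoundaryConditionAt D f v x := by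
  intro y ρ hρ hdisj hx α hα
  refine hw y ρ hρ (hdisj.mono_right (posSet_mono hle)) hx α fun ε hε => ?_
  filter_upwards [hα ε hε, self_mem_nhdsWithin] with z hz hzD
  exact (hle z hzD).trans hz

lemma eventually_notMem_of_notMem_closure (hx : x ∉ closure D) : ∀ᶠ y in 𝓝 x, y ∉ D := by
  filter_upwards [isClosed_closure.isOpen_compl.mem_nhds hx] with y hy
  exact fun h => hy (subset_closure h)

lemma eventually_mul_lt_of_hasDerivAt {φ : ℝ → ℝ} {s c : ℝ} (hφ : HasDerivAt φ s 0)
    (hφ0 : φ 0 = 0) (hc : c < s) : ∀ᶠ t in 𝓝[>] 0, c * t < φ t := by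
  filter_upwards [hφ.tendsto_slope_zero_right.eventually (lt_mem_nhds hc), self_mem_nhdsWithin]
    with t ht (ht0 : 0 < t)
  rwa [zero_add, hφ0, sub_zero, smul_eq_mul, inv_mul_eq_div, lt_div_iff₀ ht0] at ht

lemma mul_max_inner_add_le {x e y : Plane} {ρ t α ε : ℝ} (he : ‖e‖ = 1) (hρ : 0 < ρ)
    (hxy : x ∈ sphere y ρ) (ht : 0 ≤ t) :
    α * max ⟪x + t • e - x, ρ⁻¹ • (x - y)⟫ 0 + ε * ‖x + t • e - x‖ ≤ (max α 0 + ε) * t := by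
  have hnormal : ‖ρ⁻¹ • (x - y)‖ = 1 := by
    rw [mem_sphere, dist_eq_norm] at hxy
    rw [norm_smul, hxy, norm_inv, Real.norm_of_nonneg hρ.le, inv_mul_cancel₀ hρ.ne']
  have hstep : ‖t • e‖ = t := by rw [norm_smul, he, Real.norm_of_nonneg ht, mul_one]
  have hinner : max ⟪t • e, ρ⁻¹ • (x - y)⟫ 0 ≤ t := by
    refine max_le ((real_inner_le_norm _ _).trans ?_) ht
    rw [hnormal, hstep, mul_one]
  rw [add_sub_cancel_left, hstep, add_mul]
  gcongr
  exact le_max_left _ _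

lemma subFreeBoundaryConditionAt_of_slope {L : Plane → ℝ} {e : Plane} {s : ℝ} (hx : x ∉ closure D)
    (hle : L ≤ᶠ[𝓝 x] v) (hL : L x = 0) (he : ‖e‖ = 1) (hs : 0 < s) (hfs : √(f x) ≤ s)
    (hd : HasDerivAt (fun t : ℝ => L (x + t • e)) s 0) : SubFreeBoundaryConditionAt D f v x := by
  intro y ρ hρ _ hxy α hα
  by_contra! hlt
  have hαs : max α 0 < s := max_lt (hlt.trans_le hfs) hs
  set ε := (s - max α 0) / 3 with hε
  have hε0 : 0 < ε := by linarith
  have hline : Tendsto (fun t : ℝ => x + t • e) (𝓝[>] 0) (𝓝 x) := by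
    have hcont : Continuous fun t : ℝ => x + t • e := by fun_prop
    exact (hcont.tendsto' 0 x (by rw [zero_smul, add_zero])).mono_left nhdsWithin_le_nhds
  have hlineD : Tendsto (fun t : ℝ => x + t • e) (𝓝[>] 0) (𝓝[Dᶜ] x) :=
    tendsto_nhdsWithin_iff.2 ⟨hline, hline.eventually (eventually_notMem_of_notMem_closure hx)⟩
  have hlower : ∀ᶠ t in 𝓝[>] (0 : ℝ), (s - ε) * t < L (x + t • e) :=
    eventually_mul_lt_of_hasDerivAt hd (by rw [zero_smul, add_zero, hL]) (by linarith)
  have hupper : ∀ᶠ t in 𝓝[>] (0 : ℝ), v (x + t • e) ≤ (max α 0 + ε) * t := by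
    filter_upwards [hlineD.eventually (hα ε hε0), self_mem_nhdsWithin] with t hvt ht
    exact hvt.trans (mul_max_inner_add_le he hρ hxy (le_of_lt ht))
  obtain ⟨t, ⟨⟨htlower, htupper⟩, htL⟩, ht⟩ :=
    (((hlower.and hupper).and (hline.eventually hle)).and self_mem_nhdsWithin).exists
  have hslopes : s - ε < max α 0 + ε :=
    lt_of_mul_lt_mul_right (htlower.trans_le (htL.trans htupper)) (le_of_lt ht)
  linarith

lemma nonpos_of_mem_freeBoundary (hv : LowerSemicontinuousOn v Dᶜ) (hx : x ∈ freeBoundary D v) :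
    v x ≤ 0 := by
  by_contra! hpos
  obtain ⟨y, hy, hvy⟩ := ((mem_closure_iff_frequently.1 hx.2).and_eventually
    (eventually_nhdsWithin_iff.1 (hv x hx.1.1 0 hpos))).exists
  exact hy.2 ⟨hy.1, hvy hy.1⟩

lemma mem_freeBoundary_of_nonpos (hx : x ∉ D) (hv : v x ≤ 0) (hcl : x ∈ closure (posSet D v)) :
    x ∈ freeBoundary D v :=
  ⟨⟨hx, hcl⟩, subset_closure ⟨hx, fun hpos => hpos.2.not_ge hv⟩⟩

lemma isClosed_freeBoundary (hD : IsOpen D) : IsClosed (freeBoundary D v) :=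
  (hD.isClosed_compl.inter isClosed_closure).inter isClosed_closure

end FreeBoundary

section Subsolution

variable {D : Set Plane} {f g h v v₀ w : Plane → ℝ} {x : Plane}

lemma isSubsolution_of_pointwise (hc : ContinuousOn v Dᶜ) (hnn : ∀ x ∉ D, 0 ≤ v x)
    (hsub : ∀ x ∉ closure D, 0 < v x → ViscositySubharmonicAt v x)
    (hle : ∀ x ∈ frontier D, v x ≤ g x)
    (hfb : ∀ x ∉ D, v x = 0 → x ∈ closure (posSet D v) → SubFreeBoundaryConditionAt D f v x) :
    IsSubsolution D f g v where
  continuousOn := hc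
  nonneg := hnn
  subharmonic x hx hxD := hsub x hxD hx.2
  le_boundary := hle
  free_boundary x hx := hfb x hx.1.1 (le_antisymm
    (nonpos_of_mem_freeBoundary hc.lowerSemicontinuousOn hx) (hnn x hx.1.1)) hx.1.2

lemma IsSubsolution.viscositySubharmonicAt (hv : IsSubsolution D f g v) (hx : x ∉ closure D)
    (hpos : 0 < v x) : ViscositySubharmonicAt v x :=
  hv.subharmonic x ⟨fun h => hx (subset_closure h), hpos⟩ hx

lemma IsSubsolution.subFreeBoundaryConditionAt_of_le (hw : IsSubsolution D f g w)
    (hle : ∀ x ∉ D, w x ≤ v x) (hx : x ∉ D) (hv : v x = 0) (hcl : x ∈ closure (posSet D w)) :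
    SubFreeBoundaryConditionAt D f v x :=
  SubFreeBoundaryConditionAt.of_le (w := w)
    (hw.free_boundary x (mem_freeBoundary_of_nonpos hx ((hle x hx).trans hv.le) hcl)) hle

lemma posSet_max_subset : posSet D (fun x => max (v x) (w x)) ⊆ posSet D v ∪ posSet D w :=
  fun _ hy => (lt_max_iff.1 hy.2).imp (⟨hy.1, ·⟩) (⟨hy.1, ·⟩)

lemma IsSubsolution.of_ge (hv : IsSubsolution D f g v) (hc : ContinuousOn w Dᶜ)
    (hle : ∀ x ∉ D, v x ≤ w x) (hsub : ∀ x ∉ closure D, v x < w x → ViscositySubharmonicAt w x)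
    (hwg : ∀ x ∈ frontier D, w x ≤ g x)
    (hfb : ∀ x ∉ D, w x = 0 → x ∉ closure (posSet D v) → x ∈ closure (posSet D w) →
      SubFreeBoundaryConditionAt D f w x) : IsSubsolution D f g w := by
  refine isSubsolution_of_pointwise hc (fun x hx => (hv.nonneg x hx).trans (hle x hx))
    (fun x hxD hpos => ?_) hwg fun x hx hzero hcl => ?_
  · rcases (hle x fun h => hxD (subset_closure h)).eq_or_lt with heq | hlt
    · exact (hv.viscositySubharmonicAt hxD (heq ▸ hpos)).of_le
        ((eventually_notMem_of_notMem_closure hxD).mono hle) heq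
    · exact hsub x hxD hlt
  · by_cases hclv : x ∈ closure (posSet D v)
    · exact hv.subFreeBoundaryConditionAt_of_le hle hx hzero hclv
    · exact hfb x hx hzero hclv hcl

lemma IsSubsolution.sup (hv : IsSubsolution D f g v) (hw : IsSubsolution D f g w) :
    IsSubsolution D f g fun x => max (v x) (w x) := by
  refine hv.of_ge (hv.continuousOn.sup hw.continuousOn) (fun x _ => le_max_left _ _)
    (fun x hxD hlt => ?_) (fun x hx => max_le (hv.le_boundary x hx) (hw.le_boundary x hx))
    fun x hx hzero hclv hcl => ?_
  · have hvw : v x < w x := (lt_max_iff.1 hlt).resolve_left (lt_irrefl _)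
    exact (hw.viscositySubharmonicAt hxD
      ((hv.nonneg x fun h => hxD (subset_closure h)).trans_lt hvw)).of_le
      (Eventually.of_forall fun y => le_max_right _ _) (max_eq_right hvw.le).symm
  · have hcl_union := closure_mono posSet_max_subset hcl
    rw [closure_union] at hcl_union
    exact hw.subFreeBoundaryConditionAt_of_le (fun _ _ => le_max_right _ _) hx hzero
      (hcl_union.resolve_left hclv)

/-- The competitors in the definition of the largest subsolution. -/
def Admissible (D : Set Plane) (f g h v : Plane → ℝ) : Prop :=
  IsSubsolution D f g v ∧ ∀ y ∉ D, v y ≤ h y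

lemma Admissible.sup (hv : Admissible D f g h v) (hw : Admissible D f g h w) :
    Admissible D f g h fun x => max (v x) (w x) :=
  ⟨hv.1.sup hw.1, fun y hy => max_le (hv.2 y hy) (hw.2 y hy)⟩

lemma Admissible.le_largestSubsolution (hv : Admissible D f g h v) (hx : x ∉ D) :
    v x ≤ largestSubsolution D f g h x := by
  refine le_csSup ⟨h x, ?_⟩ ⟨v, hv.1, hv.2, rfl⟩
  rintro t ⟨w, _, hw, rfl⟩
  exact hw x hx

lemma largestSubsolution_nonneg (h₀ : Admissible D f g h v₀) (hx : x ∉ D) :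
    0 ≤ largestSubsolution D f g h x :=
  (h₀.1.nonneg x hx).trans (h₀.le_largestSubsolution hx)

lemma exists_admissible_lt (h₀ : Admissible D f g h v₀) {c : ℝ}
    (hc : c < largestSubsolution D f g h x) : ∃ v, Admissible D f g h v ∧ c < v x := by
  obtain ⟨_, ⟨v, hv, hvh, rfl⟩, hlt⟩ :=
    exists_lt_of_lt_csSup (by exact ⟨v₀ x, v₀, h₀.1, h₀.2, rfl⟩) hc
  exact ⟨v, ⟨hv, hvh⟩, hlt⟩

lemma largestSubsolution_le_of_forall (h₀ : Admissible D f g h v₀) {c : ℝ}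
    (hc : ∀ v, Admissible D f g h v → v x ≤ c) : largestSubsolution D f g h x ≤ c := by
  by_contra! hlt
  obtain ⟨v, hv, hvx⟩ := exists_admissible_lt h₀ hlt
  exact hvx.not_ge (hc v hv)

lemma largestSubsolution_le (h₀ : Admissible D f g h v₀) (hx : x ∉ D) :
    largestSubsolution D f g h x ≤ h x :=
  largestSubsolution_le_of_forall h₀ fun _ hv => hv.2 x hx

lemma lowerSemicontinuousOn_largestSubsolution (h₀ : Admissible D f g h v₀) :
    LowerSemicontinuousOn (largestSubsolution D f g h) Dᶜ := by
  intro x hx c hc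
  obtain ⟨v, hv, hvx⟩ := exists_admissible_lt h₀ hc
  filter_upwards [hv.1.continuousOn.lowerSemicontinuousOn x hx c hvx, self_mem_nhdsWithin]
    with y hy hyD using hy.trans_le (hv.le_largestSubsolution hyD)

lemma exists_admissible_lt_of_isCompact (h₀ : Admissible D f g h v₀) {K : Set Plane}
    (hK : IsCompact K) (hKD : K ⊆ Dᶜ) {c : ℝ} (hc : ∀ x ∈ K, c < largestSubsolution D f g h x) :
    ∃ v, Admissible D f g h v ∧ ∀ x ∈ K, c < v x := by
  refine hK.induction_on (p := fun s => ∃ v, Admissible D f g h v ∧ ∀ x ∈ s, c < v x)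
    ?_ ?_ ?_ fun x hx => ?_
  · exact ⟨v₀, h₀, fun x hx => absurd hx (notMem_empty x)⟩
  · rintro s t hst ⟨v, hv, hlt⟩
    exact ⟨v, hv, fun x hx => hlt x (hst hx)⟩
  · rintro s t ⟨v, hv, hltv⟩ ⟨w, hw, hltw⟩
    exact ⟨_, hv.sup hw, fun x hx => lt_max_iff.2 (hx.imp (hltv x) (hltw x))⟩
  · obtain ⟨v, hv, hvx⟩ := exists_admissible_lt h₀ (hc x hx)
    exact ⟨{y | c < v y}, nhdsWithin_mono x hKD
      (hv.1.continuousOn.lowerSemicontinuousOn x (hKD hx) c hvx), v, hv, fun y hy => hy⟩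

end Subsolution

section Perron

variable {D : Set Plane} {f g h v v₀ H : Plane → ℝ} {c x : Plane} {R : ℝ}

lemma le_on_closedBall_of_viscositySubharmonicAt (hR : R ≠ 0)
    (hv : ContinuousOn v (closedBall c R)) (hH : ContinuousOn H (closedBall c R))
    (hharm : HarmonicOnNhd H (ball c R)) (hsub : ∀ x ∈ ball c R, ViscositySubharmonicAt v x)
    (hle : ∀ x ∈ sphere c R, v x ≤ H x) : ∀ x ∈ closedBall c R, v x ≤ H x := by
  rw [← closure_ball c hR] at hv hH ⊢
  rw [← frontier_ball c hR] at hle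
  exact le_of_viscositySubharmonicAt isOpen_ball isBounded_ball hv hH hharm
    (fun x hx _ => hsub x hx) hle

open Classical in
lemma IsSubsolution.piecewise_ball (hv : IsSubsolution D f g v) (hR : R ≠ 0)
    (hball : closedBall c R ⊆ (closure D)ᶜ) (hpos : ∀ x ∈ ball c R, 0 < v x)
    (hHc : ContinuousOn H (closedBall c R)) (hHh : HarmonicOnNhd H (ball c R))
    (hHv : EqOn H v (sphere c R)) (hvH : ∀ x ∈ ball c R, v x ≤ H x) :
    IsSubsolution D f g ((ball c R).piecewise H v) := by
  have hwH : EqOn ((ball c R).piecewise H v) H (ball c R) := piecewise_eqOn _ _ _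
  have hwv : EqOn ((ball c R).piecewise H v) v (ball c R)ᶜ := piecewise_eqOn_compl _ _ _
  refine hv.of_ge ?_ (fun x _ => ?_) (fun x _ hlt => ?_) (fun x hx => ?_)
    fun x _ _ hnot hcl => absurd (closure_mono ?_ hcl) hnot
  · refine ContinuousOn.piecewise (fun x hx => ?_) ?_ ?_
    · rw [frontier_ball c hR] at hx
      exact hHv hx.2
    · rw [closure_ball c hR]
      exact hHc.mono inter_subset_right
    · exact hv.continuousOn.mono inter_subset_left
  · exact le_piecewise (s := ball c R) (fun x hx => hvH x hx) (fun x _ => le_rfl) x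
  · have hxb : x ∈ ball c R := by
      by_contra hn
      exact hlt.ne (hwv hn).symm
    exact viscositySubharmonicAt_of_harmonicAt ((harmonicAt_congr_nhds
      (hwH.eventuallyEq_of_mem (isOpen_ball.mem_nhds hxb))).2 (hHh x hxb))
  · rw [hwv fun hxb => hball (ball_subset_closedBall hxb) hx.1]
    exact hv.le_boundary x hx
  · rintro y ⟨hyD, hy⟩
    by_cases hyb : y ∈ ball c R
    · exact ⟨hyD, hpos y hyb⟩
    · exact ⟨hyD, by rwa [hwv hyb] at hy⟩

/-- The properties of the upper barrier used in Perron's method. -/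
structure IsUpperBarrier (D : Set Plane) (h : Plane → ℝ) : Prop where
  nonneg : ∀ x, 0 ≤ h x
  harmonic : ∀ x ∉ D, 0 < h x → HarmonicAt h x
  support : ∃ (c : Plane) (R : ℝ), ∀ x, R ≤ dist x c → h x = 0

open Classical in
lemma Admissible.exists_harmonic_replacement (hh : IsUpperBarrier D h) (hv : Admissible D f g h v)
    (hR : 0 < R) (hball : closedBall c R ⊆ (closure D)ᶜ) (hpos : ∀ x ∈ closedBall c R, 0 < v x) :
    ∃ w, Admissible D f g h w ∧ (∀ x, v x ≤ w x) ∧ HarmonicOnNhd w (ball c R) := by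
  have hballD : closedBall c R ⊆ Dᶜ := fun x hx h => hball hx (subset_closure h)
  have hvc : ContinuousOn v (closedBall c R) := hv.1.continuousOn.mono hballD
  obtain ⟨H, hHc, hHh, hHv⟩ := exists_harmonic_extension hR (hvc.mono sphere_subset_closedBall)
  have hhh : HarmonicOnNhd h (closedBall c R) := fun x hx =>
    hh.harmonic x (hballD hx) ((hpos x hx).trans_le (hv.2 x (hballD hx)))
  have hvH : ∀ x ∈ closedBall c R, v x ≤ H x :=
    le_on_closedBall_of_viscositySubharmonicAt hR.ne' hvc hHc hHh
      (fun x hx => hv.1.viscositySubharmonicAt (hball (ball_subset_closedBall hx))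
        (hpos x (ball_subset_closedBall hx))) fun x hx => (hHv hx).ge
  have hHh_le : ∀ x ∈ closedBall c R, H x ≤ h x :=
    le_on_closedBall_of_viscositySubharmonicAt hR.ne' hHc hhh.continuousOn
      (hhh.mono ball_subset_closedBall)
      (fun x hx => viscositySubharmonicAt_of_harmonicAt (hHh x hx))
      fun x hx => (hHv hx).trans_le (hv.2 x (hballD (sphere_subset_closedBall hx)))
  refine ⟨(ball c R).piecewise H v, ⟨hv.1.piecewise_ball hR.ne' hball
    (fun x hx => hpos x (ball_subset_closedBall hx)) hHc hHh hHv
    fun x hx => hvH x (ball_subset_closedBall hx), fun x hx => ?_⟩,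
    le_piecewise (fun x hx => hvH x (ball_subset_closedBall hx)) fun x _ => le_rfl,
    fun x hx => (harmonicAt_congr_nhds ((piecewise_eqOn _ _ _).eventuallyEq_of_mem
      (isOpen_ball.mem_nhds hx))).2 (hHh x hx)⟩
  by_cases hxb : x ∈ ball c R
  · rw [piecewise_eq_of_mem _ _ _ hxb]
    exact hHh_le x (ball_subset_closedBall hxb)
  · rw [piecewise_eq_of_notMem _ _ _ hxb]
    exact hv.2 x hx

lemma exists_admissible_seq (h₀ : Admissible D f g h v₀) (q : ℕ → Plane) :
    ∃ a : ℕ → Plane → ℝ, (∀ n, Admissible D f g h (a n)) ∧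
      ∀ k, ∀ t < largestSubsolution D f g h (q k), ∃ n, t < a n (q k) := by
  have hchoose : ∀ i : ℕ × ℚ, ∃ v, Admissible D f g h v ∧
      ((i.2 : ℝ) < largestSubsolution D f g h (q i.1) → (i.2 : ℝ) < v (q i.1)) := by
    intro i
    by_cases hi : (i.2 : ℝ) < largestSubsolution D f g h (q i.1)
    · obtain ⟨v, hv, hlt⟩ := exists_admissible_lt h₀ hi
      exact ⟨v, hv, fun _ => hlt⟩
    · exact ⟨v₀, h₀, fun hlt => absurd hlt hi⟩
  choose a ha hlt using hchoose
  obtain ⟨e, he⟩ := exists_surjective_nat (ℕ × ℚ)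
  refine ⟨a ∘ e, fun n => ha (e n), fun k t ht => ?_⟩
  obtain ⟨s, hts, hs⟩ := exists_rat_btwn ht
  obtain ⟨n, hn⟩ := he (k, s)
  refine ⟨n, hts.trans ?_⟩
  have := hlt (e n)
  rw [hn] at this
  rw [Function.comp_apply, hn]
  exact this hs

lemma exists_monotone_harmonic_seq (hh : IsUpperBarrier D h) (h₀ : Admissible D f g h v₀)
    (hR : 0 < R) (hball : closedBall c R ⊆ (closure D)ᶜ) (hpos : ∀ x ∈ closedBall c R, 0 < v₀ x)
    {a : ℕ → Plane → ℝ} (ha : ∀ n, Admissible D f g h (a n)) :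
    ∃ b : ℕ → Plane → ℝ, (∀ n, Admissible D f g h (b n)) ∧ Monotone b ∧ (∀ n, a n ≤ b n) ∧
      ∀ n, HarmonicOnNhd (b n) (ball c R) := by
  have hstep : ∀ b : {v // Admissible D f g h v ∧ v₀ ≤ v}, ∀ n : ℕ,
      ∃ b' : {v // Admissible D f g h v ∧ v₀ ≤ v},
        b.1 ≤ b'.1 ∧ a n ≤ b'.1 ∧ HarmonicOnNhd b'.1 (ball c R) := by
    intro b n
    obtain ⟨w, hw, hle, hharm⟩ := (b.2.1.sup (ha n)).exists_harmonic_replacement hh hR hball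
      fun x hx => lt_max_of_lt_left ((hpos x hx).trans_le (b.2.2 x))
    have hbw : b.1 ≤ w := fun x => (le_max_left _ _).trans (hle x)
    exact ⟨⟨w, hw, b.2.2.trans hbw⟩, hbw, fun x => (le_max_right _ _).trans (hle x), hharm⟩
  choose next hmono ha_le hharm using hstep
  let b : ℕ → {v // Admissible D f g h v ∧ v₀ ≤ v} :=
    fun n => n.rec ⟨v₀, h₀, le_rfl⟩ fun k bk => next bk k
  exact ⟨fun n => (b (n + 1)).1, fun n => (b (n + 1)).2.1,
    monotone_nat_of_le_succ fun n => hmono (b (n + 1)) (n + 1), fun n => ha_le (b n) n,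
    fun n => hharm (b n) n⟩

/- Competitors approximating `u` on a countable dense set increase to a harmonic `V ≤ u`. A
competitor exceeding `V` at one point would exceed it at a point of the dense set, so `V = u`. -/
lemma harmonicOnNhd_largestSubsolution_ball (hh : IsUpperBarrier D h)
    (h₀ : Admissible D f g h v₀) (hR : 0 < R) (hball : closedBall c R ⊆ (closure D)ᶜ)
    (hpos : ∀ x ∈ closedBall c R, 0 < largestSubsolution D f g h x) :
    HarmonicOnNhd (largestSubsolution D f g h) (ball c R) := by
  have hballD : closedBall c R ⊆ Dᶜ := fun x hx h => hball hx (subset_closure h)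
  have hbD : ∀ x ∈ ball c R, x ∉ D := fun x hx => hballD (ball_subset_closedBall hx)
  obtain ⟨v₁, hv₁, hv₁pos⟩ := exists_admissible_lt_of_isCompact h₀ (isCompact_closedBall c R)
    hballD hpos
  obtain ⟨a, ha, hdense⟩ := exists_admissible_seq h₀ (TopologicalSpace.denseSeq Plane)
  obtain ⟨b, hb, hbmono, hab, hbharm⟩ :=
    exists_monotone_harmonic_seq hh hv₁ hR hball hv₁pos ha
  have hbu : ∀ n, ∀ x ∉ D, b n x ≤ largestSubsolution D f g h x :=
    fun n x hx => (hb n).le_largestSubsolution hx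
  set V : Plane → ℝ := fun x => ⨆ n, b n x
  have hbdd : ∀ x ∉ D, BddAbove (range fun n => b n x) := fun x hx =>
    ⟨_, forall_mem_range.2 fun n => hbu n x hx⟩
  obtain ⟨M, hM⟩ : ∃ M, ∀ x ∈ closedBall c R, |h x| ≤ M :=
    (isCompact_closedBall c R).exists_bound_of_continuousOn <| HarmonicOnNhd.continuousOn
      fun x hx => hh.harmonic x (hballD hx)
        ((hpos x hx).trans_le (largestSubsolution_le h₀ (hballD hx)))
  have hV : HarmonicOnNhd V (ball c R) := by
    refine harmonicOnNhd_of_tendsto (M := M) hbharm (fun n z hz => ?_) fun z hz =>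
      tendsto_atTop_ciSup (fun m n hmn => hbmono hmn z) (hbdd z (hbD z hz))
    rw [abs_of_nonneg ((hb n).1.nonneg z (hbD z hz))]
    exact ((hb n).2 z (hbD z hz)).trans ((le_abs_self _).trans (hM z (ball_subset_closedBall hz)))
  have hVu : EqOn (largestSubsolution D f g h) V (ball c R) := by
    intro x hx
    refine le_antisymm (largestSubsolution_le_of_forall h₀ fun w hw => ?_)
      (ciSup_le fun n => hbu n x (hbD x hx))
    by_contra! hlt
    have hwc : ContinuousAt w x := (hw.1.continuousOn x (hbD x hx)).continuousAt
      (eventually_notMem_of_notMem_closure (hball (ball_subset_closedBall hx)))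
    obtain ⟨y, ⟨k, rfl⟩, hVw, hyb⟩ :=
      (TopologicalSpace.denseRange_denseSeq Plane).inter_nhds_nonempty
        (((hV x hx).1.continuousAt.eventually_lt hwc hlt).and (isOpen_ball.mem_nhds hx))
    obtain ⟨n, hn⟩ := hdense k _ (hVw.trans_le (hw.le_largestSubsolution (hbD _ hyb)))
    exact (hn.trans_le (hab n _)).not_ge (le_ciSup (hbdd _ (hbD _ hyb)) n)
  exact fun x hx => (harmonicAt_congr_nhds
    (hVu.eventuallyEq_of_mem (isOpen_ball.mem_nhds hx))).2 (hV x hx)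

theorem harmonicAt_largestSubsolution (hh : IsUpperBarrier D h) (h₀ : Admissible D f g h v₀)
    (hx : x ∉ closure D) (hpos : 0 < largestSubsolution D f g h x) :
    HarmonicAt (largestSubsolution D f g h) x := by
  have hpos_near := eventually_nhdsWithin_iff.1 (lowerSemicontinuousOn_largestSubsolution h₀ x
    (fun h => hx (subset_closure h)) 0 hpos)
  obtain ⟨R, hR, hsub⟩ := Metric.nhds_basis_closedBall.eventually_iff.1
    (hpos_near.and (isClosed_closure.isOpen_compl.mem_nhds hx))
  exact harmonicOnNhd_largestSubsolution_ball hh h₀ hR (fun y hy => (hsub hy).2)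
    (fun y hy => (hsub hy).1 fun h => (hsub hy).2 (subset_closure h)) x (mem_ball_self hR)

lemma largestSubsolution_le_of_boundary_le (hD : IsOpen D) (hh : IsUpperBarrier D h)
    (h₀ : Admissible D f g h v₀) {M : ℝ} (hM₀ : 0 ≤ M) (hM : ∀ x ∈ frontier D, g x ≤ M)
    (hx : x ∉ D) : largestSubsolution D f g h x ≤ M := by
  refine largestSubsolution_le_of_forall h₀ fun v hv => ?_
  obtain ⟨c, R, hR⟩ := hh.support
  set U := (closure D)ᶜ ∩ ball c R
  have hopen : IsOpen U := isClosed_closure.isOpen_compl.inter isOpen_ball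
  have hclD : closure U ⊆ Dᶜ :=
    closure_minimal (fun y hy h => hy.1 (subset_closure h)) hD.isClosed_compl
  have hout : ∀ y ∉ D, y ∉ U → v y ≤ M := by
    intro y hyD hyU
    by_cases hyc : y ∈ closure D
    · have hyf : y ∈ frontier D := ⟨hyc, fun h => hyD (interior_subset h)⟩
      exact (hv.1.le_boundary y hyf).trans (hM y hyf)
    · exact (hv.2 y hyD).trans ((hR y (not_lt.1 fun hlt => hyU ⟨hyc, hlt⟩)).trans_le hM₀)
  by_cases hxU : x ∈ U
  · refine le_of_viscositySubharmonicAt hopen (isBounded_ball.subset inter_subset_right)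
      (v := v) (H := fun _ => M) (hv.1.continuousOn.mono hclD) continuousOn_const
      (harmonicOnNhd_const M)
      (fun y hy hlt => hv.1.viscositySubharmonicAt hy.1 (hM₀.trans_lt hlt)) (fun y hy => ?_) x
      (subset_closure hxU)
    exact hout y (hclD hy.1) fun h => hy.2 (by rwa [hopen.interior_eq])
  · exact hout x hx hxU

end Perron

/-! ### The lower barrier -/

section SqrtBranch

variable {U K : Set ℂ} {q : ℂ → ℂ} {a b z : ℂ} {ε : ℝ}

/-- `q` is the branch of `√((z - b) / (z - a))` on the complement of the compact set `K` that tends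
to `1` at infinity. -/
structure IsSqrtBranch (K : Set ℂ) (a b : ℂ) (q : ℂ → ℂ) : Prop where
  isCompact : IsCompact K
  analyticAt : ∀ z ∉ K, AnalyticAt ℂ q z
  sq_mul : ∀ z ∉ K, q z ^ 2 * (z - a) = z - b
  tendsto : Tendsto q (cocompact ℂ) (𝓝 1)

lemma IsSqrtBranch.mul {K₁ K₂ : Set ℂ} {q₁ q₂ : ℂ → ℂ} {c : ℂ} (h₁ : IsSqrtBranch K₁ a b q₁)
    (h₂ : IsSqrtBranch K₂ b c q₂) : IsSqrtBranch (K₁ ∪ K₂) a c fun z => q₁ z * q₂ z where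
  isCompact := h₁.isCompact.union h₂.isCompact
  analyticAt z hz :=
    (h₁.analyticAt z fun h => hz (Or.inl h)).mul (h₂.analyticAt z fun h => hz (Or.inr h))
  sq_mul z hz := by
    rw [← h₂.sq_mul z fun h => hz (Or.inr h), ← h₁.sq_mul z fun h => hz (Or.inl h)]
    ring
  tendsto := by simpa using h₁.tendsto.mul h₂.tendsto

lemma isSqrtBranch_cpow (a b : ℂ) :
    IsSqrtBranch (closedBall a (dist b a)) a b fun z => (1 + (a - b) / (z - a)) ^ (1 / 2 : ℂ) := by
  have hfar : ∀ z ∉ closedBall a (dist b a), z - a ≠ 0 ∧ ‖(a - b) / (z - a)‖ < 1 := by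
    intro z hz
    have hlt : dist b a < dist z a := by simpa using hz
    have hza : 0 < ‖z - a‖ := by
      rw [← dist_eq_norm]
      exact dist_nonneg.trans_lt hlt
    refine ⟨norm_pos_iff.1 hza, ?_⟩
    rwa [norm_div, div_lt_one hza, ← dist_eq_norm, ← dist_eq_norm, dist_comm]
  refine ⟨isCompact_closedBall _ _, fun z hz => ?_, fun z hz => ?_, ?_⟩
  · have hquot : AnalyticAt ℂ (fun z => (a - b) / (z - a)) z :=
      analyticAt_const.div (analyticAt_id.sub analyticAt_const) (hfar z hz).1
    exact (analyticAt_const.add hquot).cpow analyticAt_const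
      (Complex.mem_slitPlane_of_norm_lt_one (hfar z hz).2)
  · have hza := (hfar z hz).1
    rw [← Complex.cpow_nat_mul, Nat.cast_ofNat, mul_one_div_cancel two_ne_zero, Complex.cpow_one]
    field_simp
    ring
  · have hinv : Tendsto (fun z : ℂ => (z - a)⁻¹) (cocompact ℂ) (𝓝 0) := by
      rw [← Metric.cobounded_eq_cocompact]
      exact tendsto_inv₀_cobounded.comp (tendsto_sub_const_cobounded a)
    have hbase : Tendsto (fun z : ℂ => 1 + (a - b) / (z - a)) (cocompact ℂ) (𝓝 1) := by
      simpa [div_eq_mul_inv] using (hinv.const_mul (a - b)).const_add 1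
    have hsqrt : ContinuousAt (fun w : ℂ => w ^ (1 / 2 : ℂ)) 1 :=
      continuousAt_cpow_const Complex.one_mem_slitPlane
    simpa [Function.comp_def] using hsqrt.tendsto.comp hbase

/- The functions `√((z - b) / (z - a))` with `a` and `b` close to each other multiply along a chain
of points joining any two points of `U`. -/
lemma exists_isSqrtBranch (hU : IsOpen U) (hc : IsPreconnected U) (ha : a ∈ U) (hb : b ∈ U) :
    ∃ K q, K ⊆ U ∧ IsSqrtBranch K a b q := by
  refine hc.induction₂' (P := fun x y => ∃ K q, K ⊆ U ∧ IsSqrtBranch K x y q)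
    (fun x hx => ?_) ?_ ha hb
  · obtain ⟨η, hη, hsub⟩ := Metric.isOpen_iff.1 hU x hx
    filter_upwards [nhdsWithin_le_nhds (ball_mem_nhds x (half_pos hη))]
      with y (hy : dist y x < η / 2)
    refine ⟨⟨_, _, fun z hz => hsub ?_, isSqrtBranch_cpow x y⟩,
      ⟨_, _, fun z hz => hsub ?_, isSqrtBranch_cpow y x⟩⟩ <;>
      rw [mem_closedBall] at hz <;> rw [mem_ball]
    · linarith
    · linarith [dist_triangle z y x, dist_comm x y]
  · rintro x y z _ _ _ ⟨K₁, q₁, hK₁, h₁⟩ ⟨K₂, q₂, hK₂, h₂⟩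
    exact ⟨_, _, union_subset hK₁ hK₂, h₁.mul h₂⟩

lemma IsSqrtBranch.re_ne_zero (hq : IsSqrtBranch K a b q) (hz : z ∉ K)
    (hd : dist b a < dist z a) : (q z).re ≠ 0 := by
  intro hre
  have hza : z - a ≠ 0 := sub_ne_zero.2 (dist_pos.1 (dist_nonneg.trans_lt hd))
  have hsq : q z ^ 2 = 1 - (b - a) / (z - a) := by
    rw [eq_sub_iff_add_eq, eq_div_of_mul_eq hza (hq.sq_mul z hz), ← add_div, sub_add_sub_cancel,
      div_self hza]
  have hsmall : ((b - a) / (z - a)).re < 1 := by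
    refine (Complex.re_le_norm _).trans_lt ?_
    rwa [norm_div, div_lt_one (norm_pos_iff.2 hza), ← dist_eq_norm, ← dist_eq_norm]
  have hsq_re : (q z ^ 2).re = -(q z).im ^ 2 := by
    rw [sq, Complex.mul_re, hre]
    ring
  rw [hsq, Complex.sub_re, Complex.one_re] at hsq_re
  linarith [sq_nonneg (q z).im]

lemma IsSqrtBranch.re_pos (hq : IsSqrtBranch K a b q) (hε : 0 < ε) (hK : K ⊆ ball a ε)
    (hb : dist b a < ε) (hz : ε ≤ dist z a) : 0 < (q z).re := by
  set γ : ℝ → ℂ := fun t => a + t • (z - a) with hγ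
  have hdist : ∀ t, dist (γ t) a = |t| * dist z a := fun t => by
    rw [hγ, dist_self_add_left, norm_smul, Real.norm_eq_abs, dist_eq_norm]
  have hfar : ∀ t ∈ Ici (1 : ℝ), ε ≤ dist (γ t) a := fun t (ht : 1 ≤ t) => by
    rw [hdist, abs_of_pos (by linarith)]
    nlinarith
  have hγK : ∀ t ∈ Ici (1 : ℝ), γ t ∉ K := fun t ht h => (hfar t ht).not_gt (hK h)
  have hcont : ContinuousOn (fun t => (q (γ t)).re) (Ici 1) := fun t ht =>
    (Complex.continuous_re.continuousAt.comp (ContinuousAt.comp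
      (hq.analyticAt _ (hγK t ht)).continuousAt (by fun_prop))).continuousWithinAt
  have hγlim : Tendsto γ atTop (cocompact ℂ) := by
    rw [← Metric.cobounded_eq_cocompact, ← tendsto_dist_right_atTop_iff a]
    simp only [hdist]
    exact tendsto_abs_atTop_atTop.atTop_mul_const (hε.trans_le hz)
  have hlim : Tendsto (fun t => (q (γ t)).re) atTop (𝓝 1) :=
    (Complex.continuous_re.tendsto 1).comp (hq.tendsto.comp hγlim)
  have hz1 : γ 1 = z := by simp only [hγ, one_smul, add_sub_cancel]
  by_contra! hneg
  rw [← hz1] at hneg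
  obtain ⟨T, hTpos, hT⟩ :=
    ((hlim.eventually (lt_mem_nhds one_pos)).and (eventually_ge_atTop 1)).exists
  obtain ⟨t, ht, ht0⟩ := intermediate_value_Icc hT (hcont.mono Icc_subset_Ici_self)
    ⟨hneg, hTpos.le⟩
  exact hq.re_ne_zero (hγK t ht.1) (hb.trans_le (hfar t ht.1)) ht0

end SqrtBranch

section Joukowski

variable {K : Set ℂ} {q : ℂ → ℂ} {a b z : ℂ} {ε : ℝ}

/-- The inverse `z ↦ (z - c) + √((z - a) (z - b))` of the Joukowski map with foci `a`, `b` and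
centre `c = (a + b) / 2`, the square root being `(z - a) * q z`. -/
def joukowskiInverse (a b : ℂ) (q : ℂ → ℂ) (z : ℂ) : ℂ := z - (a + b) / 2 + (z - a) * q z

lemma norm_sub_midpoint_le (a b z : ℂ) : ‖z - (a + b) / 2‖ ≤ dist z a + dist b a / 2 := by
  have hsplit : z - (a + b) / 2 = (z - a) - (b - a) / 2 := by ring
  rw [hsplit, dist_eq_norm, dist_eq_norm, ← Complex.norm_ofNat 2, ← norm_div]
  exact norm_sub_le _ _

lemma sub_half_le_norm_joukowskiInverse (hre : 0 ≤ (q z).re) :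
    dist z a - dist b a / 2 ≤ ‖joukowskiInverse a b q z‖ := by
  have hF : joukowskiInverse a b q z = (z - a) * (1 + q z) - (b - a) / 2 := by
    rw [joukowskiInverse]
    ring
  have hone : 1 ≤ ‖1 + q z‖ := by
    refine le_trans ?_ (Complex.re_le_norm _)
    rw [Complex.add_re, Complex.one_re]
    linarith
  have hhalf : ‖(b - a) / 2‖ = dist b a / 2 := by
    rw [norm_div, ← dist_eq_norm, Complex.norm_ofNat]
  have hmul : dist z a ≤ ‖(z - a) * (1 + q z)‖ := by
    rw [norm_mul, ← dist_eq_norm]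
    exact le_mul_of_one_le_right dist_nonneg hone
  rw [hF]
  linarith [norm_sub_norm_le ((z - a) * (1 + q z)) ((b - a) / 2)]

namespace IsSqrtBranch

lemma sq_sqrt (hq : IsSqrtBranch K a b q) (hz : z ∉ K) :
    ((z - a) * q z) ^ 2 = (z - a) * (z - b) := by
  rw [← hq.sq_mul z hz]
  ring

lemma joukowskiInverse_mul (hq : IsSqrtBranch K a b q) (hz : z ∉ K) :
    joukowskiInverse a b q z * (z - (a + b) / 2 - (z - a) * q z) = ((b - a) / 2) ^ 2 := by
  rw [joukowskiInverse]
  linear_combination -hq.sq_sqrt hz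

lemma joukowskiInverse_ne_zero (hq : IsSqrtBranch K a b q) (hab : a ≠ b) (hz : z ∉ K) :
    joukowskiInverse a b q z ≠ 0 := by
  intro h
  have := hq.joukowskiInverse_mul hz
  rw [h, zero_mul, eq_comm, sq_eq_zero_iff, div_eq_zero_iff] at this
  exact hab (sub_eq_zero.1 (this.resolve_right two_ne_zero)).symm

lemma analyticAt_joukowskiInverse (hq : IsSqrtBranch K a b q) (hz : z ∉ K) :
    AnalyticAt ℂ (joukowskiInverse a b q) z :=
  (analyticAt_id.sub analyticAt_const).add
    ((analyticAt_id.sub analyticAt_const).mul (hq.analyticAt z hz))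

lemma norm_sqrt_le (hq : IsSqrtBranch K a b q) (hz : z ∉ K) :
    ‖(z - a) * q z‖ ≤ dist z a + dist b a / 2 := by
  have hsq : ‖(z - a) * q z‖ ^ 2 = dist z a * dist z b := by
    rw [← norm_pow, hq.sq_sqrt hz, norm_mul, dist_eq_norm, dist_eq_norm]
  have hle : dist z b ≤ dist z a + dist b a := dist_triangle_right _ _ _ |>.trans_eq (by
    rw [dist_comm b a])
  refine le_of_sq_le_sq ?_ (by positivity)
  rw [hsq]
  nlinarith [dist_nonneg (x := z) (y := a), sq_nonneg (dist b a)]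

lemma norm_joukowskiInverse_le (hq : IsSqrtBranch K a b q) (hz : z ∉ K) :
    ‖joukowskiInverse a b q z‖ ≤ 2 * dist z a + dist b a := by
  rw [joukowskiInverse]
  linarith [norm_add_le (z - (a + b) / 2) ((z - a) * q z), norm_sub_midpoint_le a b z,
    hq.norm_sqrt_le hz]

lemma le_norm_joukowskiInverse (hq : IsSqrtBranch K a b q) (hz : z ∉ K) :
    (dist b a / 2) ^ 2 ≤ ‖joukowskiInverse a b q z‖ * (2 * dist z a + dist b a) := by
  have hprod := congrArg norm (hq.joukowskiInverse_mul hz)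
  rw [norm_mul, norm_pow, norm_div, ← dist_eq_norm b a, Complex.norm_ofNat] at hprod
  rw [← hprod]
  gcongr
  linarith [norm_sub_le (z - (a + b) / 2) ((z - a) * q z), norm_sub_midpoint_le a b z,
    hq.norm_sqrt_le hz]

lemma sqrt_ne_zero (hq : IsSqrtBranch K a b q) (hz : z ∉ K) (ha : z ≠ a) (hb : z ≠ b) :
    (z - a) * q z ≠ 0 := by
  rw [← pow_ne_zero_iff two_ne_zero, hq.sq_sqrt hz]
  exact mul_ne_zero (sub_ne_zero.2 ha) (sub_ne_zero.2 hb)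

lemma hasDerivAt_joukowskiInverse (hq : IsSqrtBranch K a b q) (hz : z ∉ K)
    (hS : (z - a) * q z ≠ 0) :
    HasDerivAt (joukowskiInverse a b q) (joukowskiInverse a b q z / ((z - a) * q z)) z := by
  set S : ℂ → ℂ := fun w => (w - a) * q w
  have hSd : HasDerivAt S (deriv S z) z :=
    ((analyticAt_id.sub analyticAt_const).mul (hq.analyticAt z hz)).differentiableAt.hasDerivAt
  have hsq : (fun w => S w ^ 2) =ᶠ[𝓝 z] fun w => (w - a) * (w - b) := by
    filter_upwards [hq.isCompact.isClosed.isOpen_compl.mem_nhds hz] with w hw using hq.sq_sqrt hw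
  have hderiv : 2 * S z * deriv S z = (z - b) + (z - a) := by
    have hprod := ((hasDerivAt_id z).sub_const a).mul ((hasDerivAt_id z).sub_const b)
    simpa using (hSd.pow 2).unique (hprod.congr_of_eventuallyEq hsq)
  have hFd := ((hasDerivAt_id z).sub_const ((a + b) / 2)).add hSd
  refine hFd.congr_deriv ?_
  rw [eq_div_iff hS, joukowskiInverse]
  linear_combination hderiv / 2

end IsSqrtBranch

lemma hasDerivAt_log_norm {γ : ℝ → ℂ} {k t : ℝ} (hγ : HasDerivAt γ (k • γ t) t) (h0 : γ t ≠ 0) :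
    HasDerivAt (fun s => Real.log ‖γ s‖) k t := by
  have hlog : (fun s => Real.log ‖γ s‖) = fun s => Real.log (‖γ s‖ ^ 2) / 2 := by
    ext s
    rw [Real.log_pow, Nat.cast_ofNat, mul_div_cancel_left₀ _ two_ne_zero]
  have : 0 < ‖γ t‖ := norm_pos_iff.2 h0
  rw [hlog]
  refine ((hγ.norm_sq.log (by positivity)).div_const 2).congr_deriv ?_
  rw [real_inner_smul_right, real_inner_self_eq_norm_sq]
  field_simp

lemma hasDerivAt_log_norm_line {F : ℂ → ℂ} {s : ℂ} (hF : HasDerivAt F (F z / s) z) (h0 : F z ≠ 0)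
    (hs : s ≠ 0) : HasDerivAt (fun t : ℝ => Real.log ‖F (z + t • -(s / ‖s‖))‖) (-‖s‖⁻¹) 0 := by
  have hz : z + (0 : ℝ) • -(s / ‖s‖) = z := by rw [zero_smul, add_zero]
  have hline : HasDerivAt (fun t : ℝ => z + t • -(s / ‖s‖)) (-(s / ‖s‖)) 0 := by
    simpa using ((hasDerivAt_id (0 : ℝ)).smul_const (-(s / ‖s‖))).const_add z
  have hcomp := HasDerivAt.scomp (𝕜' := ℂ) 0 (by rwa [hz]) hline
  refine hasDerivAt_log_norm (hcomp.congr_deriv ?_) (by rwa [hz])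
  have hnorm : (‖s‖ : ℂ) ≠ 0 := by exact_mod_cast norm_ne_zero_iff.2 hs
  rw [hz, smul_eq_mul, Complex.real_smul, Complex.ofReal_neg, Complex.ofReal_inv]
  field_simp

end Joukowski

section LogBarrier

variable {E F : Type*} [NormedAddCommGroup E] [InnerProductSpace ℝ E] [FiniteDimensional ℝ E]
  [NormedAddCommGroup F] [InnerProductSpace ℝ F] [FiniteDimensional ℝ F]

/-- A harmonic function off `D` that is bounded above, positive within `2 * ε` of `a`, negative
beyond `7 * ε`, and whose graph has slope at least `1 / (8 * ε)` up to that distance. -/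
structure IsLogBarrier (D : Set E) (a : E) (ε : ℝ) (L : E → ℝ) : Prop where
  harmonicAt : ∀ x ∉ D, HarmonicAt L x
  le : ∀ x ∉ D, L x ≤ 8
  pos : ∀ x ∉ D, dist x a < 2 * ε → 0 < L x
  neg : ∀ x ∉ D, 7 * ε ≤ dist x a → L x < 0
  slope : ∀ x ∉ D, dist x a ≤ 7 * ε → ∃ (e : E) (s : ℝ), ‖e‖ = 1 ∧ 1 / (8 * ε) ≤ s ∧
    HasDerivAt (fun t : ℝ => L (x + t • e)) s 0

lemma IsLogBarrier.comp_affineIsometryEquiv {D : Set E} {a : E} {ε : ℝ} {L : F → ℝ}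
    (e : E ≃ᵃⁱ[ℝ] F) (h : IsLogBarrier (e '' D) (e a) ε L) : IsLogBarrier D a ε (L ∘ e) := by
  have hmem : ∀ x ∉ D, e x ∉ e '' D := fun x hx => (e.injective.mem_set_image).not.2 hx
  refine ⟨fun x hx => harmonicAt_comp_affineIsometryEquiv e (h.harmonicAt _ (hmem x hx)),
    fun x hx => h.le _ (hmem x hx), fun x hx hd => h.pos _ (hmem x hx) (by rwa [e.dist_map]),
    fun x hx hd => h.neg _ (hmem x hx) (by rwa [e.dist_map]), fun x hx hd => ?_⟩
  obtain ⟨u, s, hu, hs, hder⟩ := h.slope _ (hmem x hx) (by rwa [e.dist_map])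
  refine ⟨e.linearIsometryEquiv.symm u, s, by rwa [LinearIsometryEquiv.norm_map], hs, ?_⟩
  refine hder.congr_of_eventuallyEq (Eventually.of_forall fun t => ?_)
  simp only [Function.comp_apply]
  rw [add_comm x, ← vadd_eq_add, e.map_vadd, vadd_eq_add, map_smul,
    LinearIsometryEquiv.apply_symm_apply, add_comm]

lemma log_1440_le : Real.log 1440 ≤ 8 := by
  rw [Real.log_le_iff_le_exp (by norm_num)]
  have hexp := Real.exp_one_gt_d9
  calc (1440 : ℝ) ≤ 2.7 ^ 8 := by norm_num
    _ ≤ Real.exp 1 ^ 8 := by gcongr; linarith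
    _ = Real.exp 8 := by rw [← Real.exp_nat_mul]; norm_num

lemma IsSqrtBranch.isLogBarrier {D K : Set ℂ} {q : ℂ → ℂ} {a b : ℂ} {ε : ℝ}
    (hq : IsSqrtBranch K a b q) (hK : K ⊆ D ∩ ball a ε) (ha : a ∈ D) (hb : b ∈ D) (hε : 0 < ε)
    (hlt : dist b a < ε) (hge : ε / 2 ≤ dist b a) :
    IsLogBarrier D a ε fun z => Real.log (6 * ε) - Real.log ‖joukowskiInverse a b q z‖ := by
  have hab : a ≠ b := (dist_pos.1 (by linarith)).symm
  have hKD : ∀ z ∉ D, z ∉ K := fun z hz h => hz (hK h).1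
  have hF0 : ∀ z ∉ D, joukowskiInverse a b q z ≠ 0 := fun z hz =>
    hq.joukowskiInverse_ne_zero hab (hKD z hz)
  have hFpos : ∀ z ∉ D, 0 < ‖joukowskiInverse a b q z‖ := fun z hz => norm_pos_iff.2 (hF0 z hz)
  have hfar : ∀ z, 7 * ε ≤ dist z a → 6 * ε < ‖joukowskiInverse a b q z‖ := fun z hd => by
    have hre := hq.re_pos hε (hK.trans inter_subset_right) hlt (z := z) (by linarith)
    linarith [sub_half_le_norm_joukowskiInverse (a := a) (b := b) hre.le]
  refine ⟨fun z hz => (harmonicAt_const _).sub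
    ((hq.analyticAt_joukowskiInverse (hKD z hz)).harmonicAt_log_norm (hF0 z hz)),
    fun z hz => ?_, fun z hz hd => ?_, fun z _ hd => ?_, fun z hz hd => ?_⟩
  · have hF : 6 * ε ≤ 1440 * ‖joukowskiInverse a b q z‖ := by
      rcases le_total (7 * ε) (dist z a) with hd | hd
      · linarith [hfar z hd]
      · have hbelow : (ε / 4) ^ 2 ≤ ‖joukowskiInverse a b q z‖ * (15 * ε) :=
          calc (ε / 4) ^ 2 ≤ (dist b a / 2) ^ 2 := pow_le_pow_left₀ (by positivity) (by linarith) 2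
            _ ≤ ‖joukowskiInverse a b q z‖ * (2 * dist z a + dist b a) :=
              hq.le_norm_joukowskiInverse (hKD z hz)
            _ ≤ ‖joukowskiInverse a b q z‖ * (15 * ε) := by gcongr; linarith
        nlinarith
    have hlog := Real.log_le_log (by positivity) hF
    rw [Real.log_mul (by norm_num) (hFpos z hz).ne'] at hlog
    linarith [log_1440_le]
  · refine sub_pos.2 (Real.log_lt_log (hFpos z hz) ?_)
    linarith [hq.norm_joukowskiInverse_le (hKD z hz)]
  · exact sub_neg.2 (Real.log_lt_log (by positivity) (hfar z hd))
  · have hS : (z - a) * q z ≠ 0 := hq.sqrt_ne_zero (hKD z hz) (fun h => hz (h ▸ ha))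
      fun h => hz (h ▸ hb)
    refine ⟨-((z - a) * q z / ‖(z - a) * q z‖), ‖(z - a) * q z‖⁻¹, ?_, ?_, ?_⟩
    · rw [norm_neg, norm_div, Complex.norm_real, norm_norm, div_self (norm_ne_zero_iff.2 hS)]
    · rw [← one_div]
      refine one_div_le_one_div_of_le (norm_pos_iff.2 hS) ?_
      linarith [hq.norm_sqrt_le (hKD z hz)]
    · simpa using (hasDerivAt_log_norm_line (hq.hasDerivAt_joukowskiInverse (hKD z hz) hS)
        (hF0 z hz) hS).const_sub (Real.log (6 * ε))

lemma exists_mem_connectedComponentIn_le_dist {X : Type*} [PseudoMetricSpace X]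
    [LocallyConnectedSpace X] {D : Set X} (hD : IsOpen D) (hc : IsPreconnected D) {a : X}
    (ha : a ∈ D) {r R : ℝ} (hr : 0 < r) (hrR : r < R) (hnot : ¬ D ⊆ ball a r) :
    ∃ b ∈ connectedComponentIn (D ∩ ball a R) a, r ≤ dist b a := by
  by_contra! hcon
  have haD : a ∈ D ∩ ball a R := ⟨ha, mem_ball_self (hr.trans hrR)⟩
  have hball : connectedComponentIn (D ∩ ball a R) a ⊆ ball a r := hcon
  have hclosure : closure (connectedComponentIn (D ∩ ball a R) a) ⊆ ball a R :=
    (closure_mono hball).trans (closure_ball_subset_closedBall.trans (closedBall_subset_ball hrR))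
  refine hnot ((hc.subset_of_closure_inter_subset (hD.inter isOpen_ball).connectedComponentIn
    ⟨a, ha, mem_connectedComponentIn haD⟩ ?_).trans hball)
  have hpre : IsPreconnected (closure (connectedComponentIn (D ∩ ball a R) a) ∩ D) :=
    isPreconnected_connectedComponentIn.subset_closure
      (fun x hx => ⟨subset_closure hx, (connectedComponentIn_subset _ _ hx).1⟩) inter_subset_left
  exact hpre.subset_connectedComponentIn ⟨subset_closure (mem_connectedComponentIn haD), ha⟩
    fun x hx => ⟨hx.2, hclosure hx.1⟩

lemma exists_isLogBarrier_complex {D : Set ℂ} (hD : IsOpen D) (hc : IsPreconnected D) {a : ℂ}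
    (ha : a ∈ D) {ε : ℝ} (hε : 0 < ε) (hnot : ¬ D ⊆ ball a (ε / 2)) :
    ∃ L, IsLogBarrier D a ε L := by
  obtain ⟨b, hb, hba⟩ :=
    exists_mem_connectedComponentIn_le_dist hD hc ha (half_pos hε) (half_lt_self hε) hnot
  have hsub := connectedComponentIn_subset (D ∩ ball a ε) a
  obtain ⟨K, q, hK, hq⟩ := exists_isSqrtBranch (hD.inter isOpen_ball).connectedComponentIn
    isPreconnected_connectedComponentIn
    (mem_connectedComponentIn ⟨ha, mem_ball_self hε⟩) hb
  exact ⟨_, hq.isLogBarrier (hK.trans hsub) ha (hsub hb).1 hε (hsub hb).2 hba⟩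

lemma exists_isLogBarrier {D : Set Plane} (hD : IsOpen D) (hc : IsPreconnected D) {a : Plane}
    (ha : a ∈ D) {ε : ℝ} (hε : 0 < ε) (hnot : ¬ D ⊆ ball a (ε / 2)) :
    ∃ L, IsLogBarrier D a ε L := by
  set e := complexChart a
  have hnot' : ¬ e '' D ⊆ ball (e a) (ε / 2) := fun h => hnot fun x hx => by
    simpa only [mem_ball, e.dist_map] using h (mem_image_of_mem e hx)
  obtain ⟨L, hL⟩ := exists_isLogBarrier_complex (e.toHomeomorph.isOpenMap D hD)
    (hc.image e e.continuous.continuousOn) (mem_image_of_mem e ha) hε hnot'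
  exact ⟨L ∘ e, hL.comp_affineIsometryEquiv e⟩

end LogBarrier

section LowerBarrier

variable {D : Set Plane} {m Lam δ δ₀ ε : ℝ} {f g h v w L W : Plane → ℝ} {a : Plane}

/-- A subsolution away from `∂D` for the constant coefficient `Lam`, with the boundary bound `m`,
supported within distance `δ` of `D`. No free boundary condition is imposed on `∂D`, where
competitors are kept positive. -/
structure IsLowerBarrier (D : Set Plane) (m Lam δ : ℝ) (W : Plane → ℝ) : Prop where
  continuousOn : ContinuousOn W Dᶜ
  nonneg : ∀ x, 0 ≤ W x
  le : ∀ x ∉ D, W x ≤ m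
  eq_zero : ∀ x ∉ D, δ ≤ infDist x D → W x = 0
  subharmonic : ∀ x ∉ closure D, 0 < W x → ViscositySubharmonicAt W x
  free_boundary : ∀ x ∉ closure D, W x = 0 → x ∈ closure (posSet D W) →
    SubFreeBoundaryConditionAt D (fun _ => Lam) W x

lemma isLowerBarrier_zero (hm : 0 ≤ m) : IsLowerBarrier D m Lam δ fun _ => 0 where
  continuousOn := continuousOn_const
  nonneg _ := le_rfl
  le _ _ := hm
  eq_zero _ _ _ := rfl
  subharmonic _ _ h := absurd h (lt_irrefl _)
  free_boundary x _ _ hcl := by simp [posSet] at hcl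

lemma IsLowerBarrier.sup (hv : IsLowerBarrier D m Lam δ v) (hw : IsLowerBarrier D m Lam δ w) :
    IsLowerBarrier D m Lam δ fun x => max (v x) (w x) where
  continuousOn := ContinuousOn.sup hv.continuousOn hw.continuousOn
  nonneg x := le_max_of_le_left (hv.nonneg x)
  le x hx := max_le (hv.le x hx) (hw.le x hx)
  eq_zero x hx hd := by rw [hv.eq_zero x hx hd, hw.eq_zero x hx hd, max_self]
  subharmonic x hx hpos := by
    rcases le_total (w x) (v x) with hle | hle
    · rw [max_eq_left hle] at hpos
      exact (hv.subharmonic x hx hpos).of_le (Eventually.of_forall fun y => le_max_left _ _)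
        (max_eq_left hle).symm
    · rw [max_eq_right hle] at hpos
      exact (hw.subharmonic x hx hpos).of_le (Eventually.of_forall fun y => le_max_right _ _)
        (max_eq_right hle).symm
  free_boundary x hx h0 hcl := by
    have hv0 : v x = 0 := le_antisymm ((le_max_left _ _).trans h0.le) (hv.nonneg x)
    have hw0 : w x = 0 := le_antisymm ((le_max_right _ _).trans h0.le) (hw.nonneg x)
    rcases closure_union.subset (closure_mono posSet_max_subset hcl) with hcl | hcl
    · exact (hv.free_boundary x hx hv0 hcl).of_le fun _ _ => le_max_left _ _
    · exact (hw.free_boundary x hx hw0 hcl).of_le fun _ _ => le_max_right _ _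

lemma IsLowerBarrier.mono {δ' : ℝ} (hW : IsLowerBarrier D m Lam δ W) (hδ : δ ≤ δ') :
    IsLowerBarrier D m Lam δ' W :=
  { hW with eq_zero := fun x hx hd => hW.eq_zero x hx (hδ.trans hd) }

lemma IsLogBarrier.isLowerBarrier (hL : IsLogBarrier D a ε L) (ha : a ∈ D) (hε : 0 < ε)
    (hm : 0 < m) (hLam : √Lam ≤ m / 8 * (1 / (8 * ε))) :
    IsLowerBarrier D m Lam (7 * ε) fun x => m / 8 * max (L x) 0 := by
  have hcL : ∀ x ∉ D, ContinuousAt L x := fun x hx => (hL.harmonicAt x hx).1.continuousAt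
  have hκ : 0 < m / 8 := by positivity
  have hLW : ∀ x, m / 8 * L x ≤ m / 8 * max (L x) 0 := fun x =>
    mul_le_mul_of_nonneg_left (le_max_left _ _) hκ.le
  have hpos : ∀ {x}, 0 < m / 8 * max (L x) 0 → 0 < L x := fun hx =>
    (lt_max_iff.1 ((mul_pos_iff_of_pos_left hκ).1 hx)).resolve_right (lt_irrefl _)
  refine ⟨fun x hx => ?_, fun x => by positivity, fun x hx => ?_, fun x hx hd => ?_,
    fun x hx hp => ?_, fun x hx h0 hcl => ?_⟩
  · exact (continuousAt_const.mul ((hcL x hx).max continuousAt_const)).continuousWithinAt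
  · have : max (L x) 0 ≤ 8 := max_le (hL.le x hx) (by norm_num)
    nlinarith
  · have hneg := hL.neg x hx (hd.trans (infDist_le_dist_of_mem ha))
    rw [max_eq_right hneg.le, mul_zero]
  · have hharm : HarmonicAt ((m / 8) • L) x :=
      (hL.harmonicAt x fun h => hx (subset_closure h)).const_smul
    refine (viscositySubharmonicAt_of_harmonicAt hharm).of_le (Eventually.of_forall hLW) ?_
    rw [Pi.smul_apply, smul_eq_mul, max_eq_left (hpos hp).le]
  · have hxD : x ∉ D := fun h => hx (subset_closure h)
    have hL0 : L x = 0 := by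
      refine le_antisymm ?_ ?_
      · by_contra! hlt
        exact (mul_pos hκ (lt_max_of_lt_left hlt)).ne' h0
      · by_contra! hlt
        obtain ⟨y, hy, hneg⟩ := ((mem_closure_iff_frequently.1 hcl).and_eventually
          ((hcL x hxD).eventually (gt_mem_nhds hlt))).exists
        exact lt_asymm hneg (hpos hy.2)
    have hd : dist x a ≤ 7 * ε := by
      by_contra! hlt
      exact (hL.neg x hxD hlt.le).ne hL0
    obtain ⟨e, s, he, hs, hder⟩ := hL.slope x hxD hd
    have hslope : m / 8 * (1 / (8 * ε)) ≤ m / 8 * s := mul_le_mul_of_nonneg_left hs hκ.le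
    exact subFreeBoundaryConditionAt_of_slope (L := fun y => m / 8 * L y) hx
      (Eventually.of_forall hLW) (by rw [hL0, mul_zero]) he
      (lt_of_lt_of_le (by positivity) hslope) (hLam.trans hslope) (hder.const_mul _)

lemma exists_isLowerBarrier_near_point (hD : IsOpen D) (hc : IsPreconnected D) (ha : a ∈ D)
    (hε : 0 < ε) (hnot : ¬ D ⊆ ball a (ε / 2)) (hm : 0 < m)
    (hLam : √Lam ≤ m / 8 * (1 / (8 * ε))) :
    ∃ W, IsLowerBarrier D m Lam (7 * ε) W ∧ ∀ x ∉ D, dist x a < 2 * ε → 0 < W x := by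
  obtain ⟨L, hL⟩ := exists_isLogBarrier hD hc ha hε hnot
  exact ⟨_, hL.isLowerBarrier ha hε hm hLam,
    fun x hx hd => mul_pos (by positivity) (lt_max_of_lt_left (hL.pos x hx hd))⟩

lemma exists_isLowerBarrier_of_scale (hD : IsOpen D) (hc : IsConnected D)
    (hb : Bornology.IsBounded D) (hε : 0 < ε) (hnot : ∀ a, ¬ D ⊆ ball a (ε / 2)) (hm : 0 < m)
    (hLam : √Lam ≤ m / 8 * (1 / (8 * ε))) :
    ∃ W, IsLowerBarrier D m Lam (7 * ε) W ∧ ∀ x ∉ D, infDist x D < ε → 0 < W x := by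
  obtain ⟨W, hW, hWpos⟩ : ∃ W, IsLowerBarrier D m Lam (7 * ε) W ∧
      ∀ x ∉ D, (∃ y ∈ closure D, dist x y < ε) → 0 < W x := by
    refine hb.isCompact_closure.induction_on (p := fun s => ∃ W, IsLowerBarrier D m Lam (7 * ε) W ∧
      ∀ x ∉ D, (∃ y ∈ s, dist x y < ε) → 0 < W x) ?_ ?_ ?_ fun x hx => ?_
    · exact ⟨_, isLowerBarrier_zero hm.le, by simp⟩
    · rintro s t hst ⟨W, hW, hpos⟩
      exact ⟨W, hW, fun x hx ⟨y, hy, hd⟩ => hpos x hx ⟨y, hst hy, hd⟩⟩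
    · rintro s t ⟨v, hv, hvpos⟩ ⟨w, hw, hwpos⟩
      refine ⟨_, hv.sup hw, ?_⟩
      rintro x hx ⟨y, hy | hy, hd⟩
      · exact lt_max_of_lt_left (hvpos x hx ⟨y, hy, hd⟩)
      · exact lt_max_of_lt_right (hwpos x hx ⟨y, hy, hd⟩)
    · obtain ⟨a, ha, hxa⟩ := Metric.mem_closure_iff.1 hx ε hε
      obtain ⟨W, hW, hWpos⟩ :=
        exists_isLowerBarrier_near_point hD hc.isPreconnected ha hε (hnot a) hm hLam
      refine ⟨ball a ε, nhdsWithin_le_nhds (isOpen_ball.mem_nhds hxa), W, hW, ?_⟩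
      rintro z hz ⟨y, (hy : dist y a < ε), hd⟩
      exact hWpos z hz (by linarith [dist_triangle z y a])
  refine ⟨W, hW, fun x hx hd => ?_⟩
  obtain ⟨y, hy, hxy⟩ := (infDist_lt_iff hc.nonempty).1 hd
  exact hWpos x hx ⟨y, subset_closure hy, hxy⟩

lemma exists_isLowerBarrier (hD : IsOpen D) (hc : IsConnected D) (hb : Bornology.IsBounded D)
    (hm : 0 < m) (hLam : 0 < Lam) (hδ : 0 < δ) :
    ∃ δ₀ > 0, ∃ W, IsLowerBarrier D m Lam δ W ∧ ∀ x ∉ D, infDist x D < δ₀ → 0 < W x := by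
  obtain ⟨a₀, ha₀⟩ := hc.nonempty
  obtain ⟨y, hy, z, hz, hyz⟩ := (infinite_of_mem_nhds a₀ (hD.mem_nhds ha₀)).nontrivial
  have : 0 < dist y z := dist_pos.2 hyz
  set ε := min (δ / 7) (min (m / 8 / (8 * √Lam)) (dist y z))
  have hε : 0 < ε := by positivity
  have hεδ : ε ≤ δ / 7 := min_le_left _ _
  have hεLam : ε ≤ m / 8 / (8 * √Lam) := (min_le_right _ _).trans (min_le_left _ _)
  have hεyz : ε ≤ dist y z := (min_le_right _ _).trans (min_le_right _ _)
  have hnot : ∀ a, ¬ D ⊆ ball a (ε / 2) := fun a hsub => by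
    linarith [mem_ball.1 (hsub hy), mem_ball.1 (hsub hz), dist_triangle_right y z a]
  have hslope : √Lam ≤ m / 8 * (1 / (8 * ε)) := by
    rw [le_div_iff₀ (by positivity)] at hεLam
    rw [mul_one_div, le_div_iff₀ (by positivity)]
    linarith
  obtain ⟨W, hW, hWpos⟩ := exists_isLowerBarrier_of_scale hD hc hb hε hnot hm hslope
  exact ⟨ε, hε, W, hW.mono (by linarith), hWpos⟩

lemma IsLowerBarrier.admissible (hW : IsLowerBarrier D m Lam δ W) (hδ₀ : 0 < δ₀)
    (hpos : ∀ x ∉ D, infDist x D < δ₀ → 0 < W x) (hD : IsOpen D)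
    (hg : ∀ x ∈ frontier D, m ≤ g x) (hf : ∀ x, f x ≤ Lam) (hh₀ : ∀ x, 0 ≤ h x)
    (hh : ∀ x ∉ D, infDist x D < δ → m ≤ h x) : Admissible D f g h W := by
  refine ⟨isSubsolution_of_pointwise hW.continuousOn (fun x _ => hW.nonneg x) hW.subharmonic
    (fun x hx => ?_) fun x hxD h0 hcl y ρ hρ hdisj hxy α hα => ?_, fun x hx => ?_⟩
  · exact (hW.le x fun h => hx.2 (by rwa [hD.interior_eq])).trans (hg x hx)
  · have hx : x ∉ closure D := fun hx =>
      (hpos x hxD (by rwa [infDist_zero_of_mem_closure hx])).ne' h0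
    exact (Real.sqrt_le_sqrt (hf x)).trans (hW.free_boundary x hx h0 hcl y ρ hρ hdisj hxy α hα)
  · rcases lt_or_ge (infDist x D) δ with hlt | hge
    · exact (hW.le x hx).trans (hh x hx hlt)
    · rw [hW.eq_zero x hx hge]
      exact hh₀ x

end LowerBarrier

/-! ### Growth at the free boundary -/

section LogSupersolution

variable {D : Set Plane} {lam r s c d m t G R κ ρ : ℝ} {p x : Plane}

lemma harmonicAt_mul_log_div_dist (hR : 0 < R) (hx : x ≠ p) :
    HarmonicAt (fun y => κ * Real.log (R / dist y p)) x := by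
  have hharm : HarmonicAt ((fun _ => κ * Real.log R) - κ • fun y => Real.log (dist y p)) x :=
    (harmonicAt_const _).sub (harmonicAt_log_dist hx).const_smul
  refine (harmonicAt_congr_nhds ?_).2 hharm
  filter_upwards [isOpen_compl_singleton.mem_nhds hx] with y hy
  rw [Real.log_div hR.ne' (dist_ne_zero.2 hy), mul_sub, Pi.sub_apply, Pi.smul_apply, smul_eq_mul]

lemma mul_log_div_dist_nonpos (hκ : 0 ≤ κ) (hR : 0 ≤ R) (hx : R ≤ dist x p) :
    κ * Real.log (R / dist x p) ≤ 0 :=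
  mul_nonpos_of_nonneg_of_nonpos hκ
    (Real.log_nonpos (by positivity) (div_le_one_of_le₀ hx dist_nonneg))

lemma log_div_eq_neg_log_div : Real.log (r / s) = -Real.log (s / r) := by
  rw [← Real.log_inv, inv_div]

lemma log_div_pos (hr : 0 < r) (hs : r < s) : 0 < Real.log (s / r) :=
  Real.log_pos ((one_lt_div hr).2 hs)

lemma one_half_le_log_div (hr : 0 < r) (hs : 2 * r ≤ s) : 1 / 2 ≤ Real.log (s / r) := by
  have : Real.log 2 ≤ Real.log (s / r) := Real.log_le_log (by norm_num) (by rwa [le_div_iff₀ hr])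
  linarith [Real.log_two_gt_d9]

lemma log_add_div_le (hr : 0 < r) (ht : 0 ≤ t) : Real.log ((r + t) / r) ≤ t / r := by
  refine (Real.log_le_sub_one_of_pos (by positivity)).trans_eq ?_
  rw [add_div, div_self hr.ne', add_sub_cancel_left]

lemma log_div_le_div_add (hR : 0 < R) (hr : 0 < r) (ht : 0 ≤ t) (hρ : 0 < ρ) (hρt : ρ ≤ r + t) :
    Real.log (R / r) ≤ Real.log (R / ρ) + t / r := by
  have hmono : Real.log (ρ / r) ≤ Real.log ((r + t) / r) :=
    Real.log_le_log (by positivity) (by gcongr)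
  have hsplit : Real.log (R / r) = Real.log (R / ρ) + Real.log (ρ / r) := by
    rw [← Real.log_mul (by positivity) (by positivity), div_mul_div_cancel₀ hρ.ne']
  linarith [log_add_div_le hr ht]

lemma strictMonoOn_mul_log_div (hr : 0 < r) :
    StrictMonoOn (fun s => s * Real.log (s / r)) (Ici r) := by
  intro s hs t _ hst
  have hs0 : 0 < s := hr.trans_le hs
  have hlog_nonneg : 0 ≤ Real.log (s / r) := Real.log_nonneg ((one_le_div hr).2 hs)
  have hlog_lt : Real.log (s / r) < Real.log (t / r) :=
    Real.log_lt_log (by positivity) (div_lt_div_of_pos_right hst hr)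
  exact mul_lt_mul'' hst hlog_lt hs0.le hlog_nonneg

lemma exists_mul_log_div_eq (hr : 0 < r) (hc : 0 < c) : ∃ R > r, R * Real.log (R / r) = c := by
  set b := r * Real.exp 1 + c
  have hrb : r ≤ b := by
    have : r * 1 ≤ r * Real.exp 1 := by gcongr; exact Real.one_le_exp zero_le_one
    linarith
  have hcont : ContinuousOn (fun s => s * Real.log (s / r)) (Icc r b) := fun s hs =>
    (continuousAt_id.mul ((continuousAt_id.div_const r).log
      (div_ne_zero (hr.trans_le hs.1).ne' hr.ne'))).continuousWithinAt
  have hb : c ≤ b * Real.log (b / r) := by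
    have hlog : 1 ≤ Real.log (b / r) := by
      rw [Real.le_log_iff_exp_le (div_pos (hr.trans_le hrb) hr), le_div_iff₀ hr]
      linarith
    calc c ≤ b := le_add_of_nonneg_left (by positivity)
      _ ≤ b * Real.log (b / r) := le_mul_of_one_le_right (hr.le.trans hrb) hlog
  obtain ⟨R, hR, hReq⟩ := intermediate_value_Icc hrb hcont
    (show c ∈ Icc (r * Real.log (r / r)) _ from
      ⟨by rw [div_self hr.ne', Real.log_one, mul_zero]; exact hc.le, hb⟩)
  refine ⟨R, lt_of_le_of_ne hR.1 ?_, hReq⟩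
  rintro rfl
  simp [div_self hr.ne', hc.ne] at hReq

lemma sq_div_lt_iff_lt_mul_log (hlam : 0 < lam) (hr : 0 < r) (hG : 0 < G) (hs : r < s) :
    G ^ 2 / (s ^ 2 * Real.log (r / s) ^ 2) < lam ↔ G / √lam < s * Real.log (s / r) := by
  have hs0 : 0 < s := hr.trans hs
  have hlog : 0 < Real.log (s / r) := log_div_pos hr hs
  rw [log_div_eq_neg_log_div, neg_sq, ← mul_pow, ← div_pow, div_lt_iff₀ (Real.sqrt_pos.2 hlam),
    ← Real.lt_sqrt (by positivity), div_lt_iff₀ (by positivity), mul_comm (√lam)]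

lemma outerRadius_spec (hlam : 0 < lam) (hr : 0 < r) (hG : 0 < G) :
    r < outerRadius lam r G ∧
      √lam * outerRadius lam r G * Real.log (outerRadius lam r G / r) = G := by
  have hsqrt : 0 < √lam := Real.sqrt_pos.2 hlam
  obtain ⟨R, hR, hReq⟩ := exists_mul_log_div_eq hr (div_pos hG hsqrt)
  have hset : {s : ℝ | r < s ∧ G ^ 2 / (s ^ 2 * Real.log (r / s) ^ 2) < lam} = Ioi R := by
    ext s
    have hiff : r < s → (G ^ 2 / (s ^ 2 * Real.log (r / s) ^ 2) < lam ↔ R < s) := fun hs => by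
      rw [sq_div_lt_iff_lt_mul_log hlam hr hG hs, ← hReq]
      exact (strictMonoOn_mul_log_div hr).lt_iff_lt hR.le hs.le
    exact ⟨fun hs => (hiff hs.1).1 hs.2, fun hs => ⟨hR.trans hs, (hiff (hR.trans hs)).2 hs⟩⟩
  have hout : outerRadius lam r G = R := by rw [outerRadius, hset, csInf_Ioi]
  rw [hout, mul_assoc, hReq, mul_div_cancel₀ _ hsqrt.ne']
  exact ⟨hR, rfl⟩

lemma logSupersolution_eq (hlam : 0 < lam) (hr : 0 < r) (hG : 0 < G) :
    logSupersolution lam p r G x =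
      max (√lam * outerRadius lam r G * Real.log (outerRadius lam r G / dist x p)) 0 := by
  obtain ⟨hR, hGeq⟩ := outerRadius_spec hlam hr hG
  have hlog : Real.log (outerRadius lam r G / r) ≠ 0 := (log_div_pos hr hR).ne'
  rw [logSupersolution, log_div_eq_neg_log_div (r := r),
    log_div_eq_neg_log_div (r := dist x p), neg_div_neg_eq]
  nth_rewrite 1 [← hGeq]
  rw [mul_assoc _ (Real.log _), mul_div_cancel₀ _ hlog]

lemma logSupersolution_eq_zero (hlam : 0 < lam) (hr : 0 < r) (hG : 0 < G)
    (hx : outerRadius lam r G ≤ dist x p) : logSupersolution lam p r G x = 0 := by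
  have hR : 0 ≤ outerRadius lam r G := (hr.trans (outerRadius_spec hlam hr hG).1).le
  rw [logSupersolution_eq hlam hr hG]
  exact max_eq_right (mul_log_div_dist_nonpos (by positivity) hR hx)

lemma harmonicAt_logSupersolution (hlam : 0 < lam) (hr : 0 < r) (hG : 0 < G) (hx : x ≠ p)
    (hlt : dist x p < outerRadius lam r G) : HarmonicAt (logSupersolution lam p r G) x := by
  have hR : 0 < outerRadius lam r G := hr.trans (outerRadius_spec hlam hr hG).1
  refine (harmonicAt_congr_nhds ?_).2
    (harmonicAt_mul_log_div_dist (κ := √lam * outerRadius lam r G) hR hx)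
  have hdist : Continuous fun y : Plane => dist y p := by fun_prop
  filter_upwards [hdist.continuousAt.eventually (gt_mem_nhds hlt),
    isOpen_compl_singleton.mem_nhds hx] with y hy (hyp : y ≠ p)
  rw [logSupersolution_eq hlam hr hG, max_eq_left]
  have := log_div_pos (dist_pos.2 hyp) hy
  positivity

lemma isUpperBarrier_logSupersolution (hlam : 0 < lam) (hr : 0 < r) (hG : 0 < G) (hp : p ∈ D) :
    IsUpperBarrier D (logSupersolution lam p r G) where
  nonneg _ := le_max_right _ _
  harmonic x hx hpos := by
    refine harmonicAt_logSupersolution hlam hr hG (fun h => hx (h ▸ hp)) ?_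
    by_contra! hle
    exact hpos.ne' (logSupersolution_eq_zero hlam hr hG hle)
  support := ⟨p, outerRadius lam r G, fun _ hx => logSupersolution_eq_zero hlam hr hG hx⟩

lemma logSupersolution_le_of_near (hlam : 0 < lam) (hr : 0 < r) (hG : 0 < G) (hd : 0 < d)
    (hdp : d ≤ dist x p) (hR : outerRadius lam r G ≤ dist x p + d) :
    logSupersolution lam p r G x ≤ 2 * √lam * d := by
  have hR0 : 0 < outerRadius lam r G := hr.trans (outerRadius_spec hlam hr hG).1
  have hdist : 0 < dist x p := hd.trans_le hdp
  have hlog : Real.log (outerRadius lam r G / dist x p) ≤ d / dist x p :=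
    (Real.log_le_log (by positivity) (by gcongr)).trans (log_add_div_le hdist hd.le)
  rw [logSupersolution_eq hlam hr hG]
  refine max_le ?_ (by positivity)
  calc √lam * outerRadius lam r G * Real.log (outerRadius lam r G / dist x p)
      ≤ √lam * outerRadius lam r G * (d / dist x p) := by gcongr
    _ ≤ √lam * (2 * dist x p) * (d / dist x p) := by gcongr; linarith
    _ = 2 * √lam * d := by field_simp

lemma sqrt_mul_outerRadius_mul_div_le (hlam : 0 < lam) (hr : 0 < r) (hG : 0 < G) (ht : 0 ≤ t)
    (htr : t ≤ r / 4) (htG : 4 * (√lam * t) ≤ G) :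
    √lam * outerRadius lam r G * (t / r) ≤ G / 2 := by
  obtain ⟨hR, hGeq⟩ := outerRadius_spec hlam hr hG
  have hR0 : 0 < outerRadius lam r G := hr.trans hR
  rcases le_total (outerRadius lam r G) (2 * r) with hle | hle
  · calc √lam * outerRadius lam r G * (t / r) ≤ √lam * (2 * r) * (t / r) := by gcongr
      _ = 2 * (√lam * t) := by field_simp
      _ ≤ G / 2 := by linarith
  · have hslope : √lam * outerRadius lam r G * (1 / 2) ≤ G := by
      nth_rewrite 2 [← hGeq]
      gcongr
      exact one_half_le_log_div hr hle
    have htr' : t / r ≤ 1 / 4 := by rw [div_le_iff₀ hr]; linarith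
    calc √lam * outerRadius lam r G * (t / r) ≤ √lam * outerRadius lam r G * (1 / 4) := by gcongr
      _ ≤ G / 2 := by linarith

lemma le_logSupersolution_of_near (hlam : 0 < lam) (hr : 0 < r) (hG : 0 < G) (ht : 0 ≤ t)
    (htr : t ≤ r / 4) (htG : 4 * (√lam * t) ≤ G) (hxp : x ≠ p) (hx : dist x p ≤ r + t) :
    G / 2 ≤ logSupersolution lam p r G x := by
  obtain ⟨hR, hGeq⟩ := outerRadius_spec hlam hr hG
  have hR0 : 0 < outerRadius lam r G := hr.trans hR
  have hlog := mul_le_mul_of_nonneg_left (log_div_le_div_add hR0 hr ht (dist_pos.2 hxp) hx)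
    (show 0 ≤ √lam * outerRadius lam r G by positivity)
  rw [hGeq, mul_add] at hlog
  rw [logSupersolution_eq hlam hr hG]
  exact le_max_of_le_left
    (by linarith [sqrt_mul_outerRadius_mul_div_le hlam hr hG ht htr htG])

end LogSupersolution

section LogGluing

variable {D : Set Plane} {f g h v : Plane → ℝ} {c x : Plane} {κ ρ R : ℝ}

/-- The radial logarithm `κ * log (R / |x - c|)`, frozen at its value on `∂B_ρ(c)` inside that ball
so as to be continuous. It vanishes on `∂B_R(c)`, with slope `κ / R`. -/
def truncatedLog (κ ρ R : ℝ) (c x : Plane) : ℝ :=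
  κ * Real.log (R / max ρ (dist x c))

lemma truncatedLog_of_dist_le (hx : dist x c ≤ ρ) :
    truncatedLog κ ρ R c x = κ * Real.log (R / ρ) := by
  rw [truncatedLog, max_eq_left hx]

lemma truncatedLog_of_le_dist (hx : ρ ≤ dist x c) :
    truncatedLog κ ρ R c x = κ * Real.log (R / dist x c) := by
  rw [truncatedLog, max_eq_right hx]

lemma continuous_truncatedLog (hρ : 0 < ρ) (hR : 0 < R) : Continuous (truncatedLog κ ρ R c) := by
  have hmax : ∀ x, 0 < max ρ (dist x c) := fun x => lt_max_of_lt_left hρ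
  refine continuous_const.mul (Continuous.log ?_ fun x => (div_pos hR (hmax x)).ne')
  exact continuous_const.div (by fun_prop) fun x => (hmax x).ne'

lemma truncatedLog_pos (hκ : 0 < κ) (hρ : 0 < ρ) (hρR : ρ < R) (hx : dist x c < R) :
    0 < truncatedLog κ ρ R c x :=
  mul_pos hκ (log_div_pos (lt_max_of_lt_left hρ) (max_lt hρR hx))

lemma truncatedLog_nonpos (hκ : 0 ≤ κ) (hR : 0 ≤ R) (hρR : ρ ≤ R) (hx : R ≤ dist x c) :
    truncatedLog κ ρ R c x ≤ 0 := by
  rw [truncatedLog_of_le_dist (hρR.trans hx)]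
  exact mul_log_div_dist_nonpos hκ hR hx

lemma truncatedLog_eventuallyEq (hx : ρ < dist x c) :
    truncatedLog κ ρ R c =ᶠ[𝓝 x] fun y => κ * Real.log (R / dist y c) := by
  have hdist : Continuous fun y : Plane => dist y c := by fun_prop
  filter_upwards [hdist.continuousAt.eventually (lt_mem_nhds hx)] with y hy
  exact truncatedLog_of_le_dist hy.le

lemma harmonicAt_truncatedLog (hρ : 0 ≤ ρ) (hR : 0 < R) (hx : ρ < dist x c) :
    HarmonicAt (truncatedLog κ ρ R c) x :=
  (harmonicAt_congr_nhds (truncatedLog_eventuallyEq hx)).2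
    (harmonicAt_mul_log_div_dist hR (dist_pos.1 (hρ.trans_lt hx)))

lemma hasDerivAt_mul_log_div_dist (hR : 0 < R) (hx : dist x c = R) :
    HasDerivAt (fun t : ℝ => κ * Real.log (R / dist (x + t • (-(R⁻¹ • (x - c)))) c)) (κ / R) 0 := by
  have hline : ∀ t : ℝ, κ * Real.log (R / dist (x + t • (-(R⁻¹ • (x - c)))) c) =
      κ * -Real.log (1 - t * R⁻¹) := by
    intro t
    have hsub : x + t • (-(R⁻¹ • (x - c))) - c = (1 - t * R⁻¹) • (x - c) := by module
    rw [dist_eq_norm, hsub, norm_smul, ← dist_eq_norm x, hx, div_mul_cancel_right₀ hR.ne',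
      Real.log_inv, Real.norm_eq_abs, Real.log_abs]
  have hinner : HasDerivAt (fun t : ℝ => 1 - t * R⁻¹) (-R⁻¹) 0 := by
    simpa using ((hasDerivAt_id (0 : ℝ)).mul_const R⁻¹).const_sub 1
  simp_rw [hline]
  simpa [div_eq_mul_inv] using (hinner.log (by simp)).neg.const_mul κ

lemma subFreeBoundaryConditionAt_truncatedLog (hκ : 0 < κ) (hR : 0 < R) (hρR : ρ < R)
    (hxD : x ∉ closure D) (hx : dist x c = R) (hf : √(f x) ≤ κ / R) :
    SubFreeBoundaryConditionAt D f (truncatedLog κ ρ R c) x := by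
  refine subFreeBoundaryConditionAt_of_slope (L := fun y => κ * Real.log (R / dist y c)) hxD
    (truncatedLog_eventuallyEq (by rwa [hx])).symm.le ?_ ?_ (div_pos hκ hR) hf
    (hasDerivAt_mul_log_div_dist hR hx)
  · rw [hx, div_self hR.ne', Real.log_one, mul_zero]
  · rw [norm_neg, norm_smul, ← dist_eq_norm, hx, norm_inv, Real.norm_of_nonneg hR.le,
      inv_mul_cancel₀ hR.ne']

lemma truncatedLog_le_of_harmonic (hκ : 0 ≤ κ) (hρ : 0 < ρ) (hρR : ρ < R) (hh₀ : ∀ x, 0 ≤ h x)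
    (hh : HarmonicOnNhd h (closedBall c R))
    (hbig : ∀ x ∈ closedBall c ρ, κ * Real.log (R / ρ) ≤ h x) :
    truncatedLog κ ρ R c x ≤ h x := by
  have hR : 0 < R := hρ.trans hρR
  have hin : ∀ y, dist y c ≤ ρ → truncatedLog κ ρ R c y ≤ h y := fun y hy =>
    (truncatedLog_of_dist_le hy).trans_le (hbig y hy)
  have hout : ∀ y, R ≤ dist y c → truncatedLog κ ρ R c y ≤ h y := fun y hy =>
    (truncatedLog_nonpos hκ hR.le hρR.le hy).trans (hh₀ y)
  rcases le_or_gt (dist x c) ρ with hxρ | hxρ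
  · exact hin x hxρ
  rcases le_or_gt R (dist x c) with hxR | hxR
  · exact hout x hxR
  set U := ball c R \ closedBall c ρ
  have hU : IsOpen U := isOpen_ball.sdiff isClosed_closedBall
  have hUR : closure U ⊆ closedBall c R :=
    closure_minimal (sdiff_subset.trans ball_subset_closedBall) isClosed_closedBall
  refine le_of_viscositySubharmonicAt hU (isBounded_ball.subset sdiff_subset)
    (continuous_truncatedLog hρ hR).continuousOn (hh.continuousOn.mono hUR)
    (hh.mono (subset_closure.trans hUR)) (fun y hy _ => ?_) (fun y hy => ?_) x
    (subset_closure ⟨hxR, hxρ.not_ge⟩)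
  · exact viscositySubharmonicAt_of_harmonicAt
      (harmonicAt_truncatedLog hρ.le hR (not_le.1 hy.2))
  · have hyU : y ∉ U := fun h => hy.2 (by rwa [hU.interior_eq])
    rcases le_or_gt (dist y c) ρ with hyρ | hyρ
    · exact hin y hyρ
    · exact hout y (not_lt.1 fun hyR => hyU ⟨hyR, hyρ.not_ge⟩)

lemma Admissible.sup_truncatedLog (hD : IsOpen D) (hv : Admissible D f g h v) (hκ : 0 < κ)
    (hρ : 0 < ρ) (hρR : ρ < R) (hball : closedBall c ρ ⊆ (closure D)ᶜ)
    (hbig : ∀ x ∈ closedBall c ρ, κ * Real.log (R / ρ) ≤ v x)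
    (hbd : ∀ x ∈ frontier D, κ * Real.log (R / dist x c) ≤ g x)
    (hvpos : ∀ x ∈ frontier D, 0 < v x) (hh₀ : ∀ x, 0 ≤ h x)
    (hh : HarmonicOnNhd h (closedBall c R)) (hf : ∀ x ∈ sphere c R, √(f x) ≤ κ / R) :
    Admissible D f g h fun x => max (v x) (truncatedLog κ ρ R c x) := by
  have hR : 0 < R := hρ.trans hρR
  have hcont := continuous_truncatedLog (κ := κ) (c := c) hρ hR
  refine ⟨hv.1.of_ge (hv.1.continuousOn.sup hcont.continuousOn) (fun x _ => le_max_left _ _)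
    (fun x _ hlt => ?_) (fun x hx => max_le (hv.1.le_boundary x hx) ?_)
    fun x _ hzero hclv hcl => ?_, fun x hx => max_le (hv.2 x hx) ?_⟩
  · have hvlog : v x < truncatedLog κ ρ R c x := (lt_max_iff.1 hlt).resolve_left (lt_irrefl _)
    have hxρ : ρ < dist x c := by
      by_contra! hle
      exact hvlog.not_ge ((truncatedLog_of_dist_le hle).trans_le (hbig x hle))
    exact (viscositySubharmonicAt_of_harmonicAt (harmonicAt_truncatedLog hρ.le hR hxρ)).of_le
      (Eventually.of_forall fun _ => le_max_right _ _) (max_eq_right hvlog.le).symm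
  · rw [truncatedLog_of_le_dist (not_le.1 fun hle => hball hle hx.1).le]
    exact hbd x hx
  · have hxcl : x ∉ closure D := fun hx => by
      have := hvpos x ⟨hx, by rwa [hD.interior_eq]⟩
      exact (lt_max_of_lt_left this).ne' hzero
    have hcllog : x ∈ closure (posSet D (truncatedLog κ ρ R c)) :=
      (closure_union.subset (closure_mono posSet_max_subset hcl)).resolve_left hclv
    have hxR : dist x c = R := by
      refine le_antisymm ?_ (not_lt.1 fun hlt =>
        (lt_max_of_lt_right (truncatedLog_pos hκ hρ hρR hlt)).ne' hzero)
      refine closure_minimal (fun y hy => ?_) isClosed_closedBall hcllog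
      exact not_lt.1 fun hlt => hy.2.not_ge (truncatedLog_nonpos hκ.le hR.le hρR.le hlt.le)
    exact (subFreeBoundaryConditionAt_truncatedLog hκ hR hρR hxcl hxR (hf x hxR)).of_le
      fun _ _ => le_max_right _ _
  · exact truncatedLog_le_of_harmonic hκ.le hρ hρR hh₀ hh fun y hy =>
      (hbig y hy).trans (hv.2 y fun hyD => hball hy (subset_closure hyD))

end LogGluing

section Positivity

variable {D A : Set Plane} {u : Plane → ℝ} {x : Plane} {d : ℝ}

lemma notMem_closure_of_infDist_pos (hx : 0 < infDist x D) : x ∉ closure D :=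
  fun h => hx.ne' (infDist_zero_of_mem_closure h)

lemma infDist_pos_of_mem_ball (hd : d ≤ infDist x D) {y : Plane} (hy : y ∈ ball x d) :
    0 < infDist y D := by
  rw [mem_ball'] at hy
  linarith [infDist_le_infDist_add_dist (s := D) (x := x) (y := y)]

lemma isOpen_union_posSet (hD : IsOpen D) (hu : LowerSemicontinuousOn u Dᶜ) :
    IsOpen (D ∪ posSet D u) := by
  refine isOpen_iff_eventually.2 ?_
  rintro y (hy | hy)
  · exact (hD.eventually_mem hy).mono fun _ => Or.inl
  · filter_upwards [eventually_nhdsWithin_iff.1 (hu y hy.1 0 hy.2)] with z hz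
    exact or_iff_not_imp_left.2 fun hzD => ⟨hzD, hz hzD⟩

lemma subset_union_posSet_of_isPreconnected (hD : IsOpen D) (hu : LowerSemicontinuousOn u Dᶜ)
    (hA : IsPreconnected A) (hne : (A ∩ (D ∪ posSet D u)).Nonempty)
    (hAF : Disjoint A (freeBoundary D u)) (hpos : ∀ y ∈ A ∩ frontier D, 0 < u y) :
    A ⊆ D ∪ posSet D u := by
  refine hA.subset_of_closure_inter_subset (isOpen_union_posSet hD hu) hne ?_
  rintro y ⟨hycl, hy⟩
  refine or_iff_not_imp_left.2 fun hyD => ⟨hyD, ?_⟩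
  rcases closure_union.subset hycl with hycl | hycl
  · exact hpos y ⟨hy, hycl, by rwa [hD.interior_eq]⟩
  · by_contra! hle
    exact disjoint_left.1 hAF hy (mem_freeBoundary_of_nonpos hyD hle hycl)

lemma ball_subset_posSet (hD : IsOpen D) (hu : LowerSemicontinuousOn u Dᶜ) (hx : x ∈ posSet D u)
    (hd : 0 < d) (hdD : d ≤ infDist x D) (hdF : d ≤ infDist x (freeBoundary D u)) :
    ball x d ⊆ posSet D u := by
  have hcl : ∀ y ∈ ball x d, y ∉ closure D := fun y hy =>
    notMem_closure_of_infDist_pos (infDist_pos_of_mem_ball hdD hy)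
  have hF : Disjoint (ball x d) (freeBoundary D u) := disjoint_left.2 fun y hy hyF => by
    rw [mem_ball'] at hy
    exact (hy.trans_le hdF).not_ge (infDist_le_dist_of_mem hyF)
  have hsub : ball x d ⊆ D ∪ posSet D u := subset_union_posSet_of_isPreconnected hD hu
    (convex_ball x d).isPreconnected ⟨x, mem_ball_self hd, Or.inr hx⟩ hF
    fun y hy => absurd hy.2.1 (hcl y hy.1)
  exact fun y hy => (hsub hy).resolve_left fun hyD => hcl y hy (subset_closure hyD)

lemma freeBoundary_nonempty (hD : IsOpen D) (hb : Bornology.IsBounded D) (hne : D.Nonempty)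
    (hu : LowerSemicontinuousOn u Dᶜ) (hpos : ∀ y ∈ frontier D, 0 < u y)
    (hsupp : Bornology.IsBounded (posSet D u)) : (freeBoundary D u).Nonempty := by
  by_contra hempty
  have hF : Disjoint univ (freeBoundary D u) := by
    rw [not_nonempty_iff_eq_empty.1 hempty]
    exact disjoint_empty _
  have huniv : univ ⊆ D ∪ posSet D u := subset_union_posSet_of_isPreconnected hD hu
    isPreconnected_univ (by simpa using hne.inl) hF fun y hy => hpos y hy.2
  exact NormedSpace.unbounded_univ ℝ Plane ((hb.union hsupp).subset huniv)

lemma infDist_freeBoundary_pos (hD : IsOpen D) (hu : LowerSemicontinuousOn u Dᶜ)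
    (hne : (freeBoundary D u).Nonempty) (hx : x ∈ posSet D u) :
    0 < infDist x (freeBoundary D u) :=
  ((isClosed_freeBoundary hD).notMem_iff_infDist_pos hne).1 fun hxF =>
    (nonpos_of_mem_freeBoundary hu hxF).not_gt hx.2

end Positivity

/-! ### Lipschitz regularity -/

section LinearGrowth

variable {D : Set Plane} {u : Plane → ℝ} {x : Plane} {c d δ M : ℝ}

/-- The properties of the largest subsolution behind its regularity: it is a nonnegative, lower
semicontinuous function on `ℝ² \ D`, harmonic where it is positive, away from `∂D`. -/
structure IsOnePhaseHarmonic (D : Set Plane) (u : Plane → ℝ) : Prop where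
  lowerSemicontinuousOn : LowerSemicontinuousOn u Dᶜ
  nonneg : ∀ x ∉ D, 0 ≤ u x
  harmonicAt : ∀ x ∉ closure D, 0 < u x → HarmonicAt u x

lemma isOnePhaseHarmonic_largestSubsolution {f g h v₀ : Plane → ℝ} (hh : IsUpperBarrier D h)
    (h₀ : Admissible D f g h v₀) : IsOnePhaseHarmonic D (largestSubsolution D f g h) where
  lowerSemicontinuousOn := lowerSemicontinuousOn_largestSubsolution h₀
  nonneg _ := largestSubsolution_nonneg h₀
  harmonicAt _ := harmonicAt_largestSubsolution hh h₀

/-- `u ≤ c * dist(·, ∂Ω(u))` at the points that are closer to the free boundary than to `D`. -/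
def HasLinearGrowth (D : Set Plane) (c : ℝ) (u : Plane → ℝ) : Prop :=
  ∀ x ∈ posSet D u, infDist x (freeBoundary D u) ≤ infDist x D →
    u x ≤ c * infDist x (freeBoundary D u)

lemma HasLinearGrowth.le_mul_infDist (hgrow : HasLinearGrowth D c u) (hD : IsOpen D)
    (hu : LowerSemicontinuousOn u Dᶜ) (hne : (freeBoundary D u).Nonempty) (hc : 0 ≤ c)
    (hM : 0 ≤ M) (huM : ∀ y ∉ D, u y ≤ M) (hδ : 0 < δ)
    (hpos : ∀ y ∉ D, infDist y D < δ → 0 < u y) (hx : x ∈ posSet D u) :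
    u x ≤ (c + 2 * M / δ) * infDist x (freeBoundary D u) := by
  set d := infDist x (freeBoundary D u)
  have hd : 0 ≤ d := infDist_nonneg
  rcases le_or_gt d (infDist x D) with hFD | hFD
  · refine (hgrow x hx hFD).trans ?_
    gcongr
    exact le_add_of_nonneg_right (by positivity)
  · obtain ⟨z, hzF, hxz⟩ := (isClosed_freeBoundary hD).exists_infDist_eq_dist hne x
    have hzD : δ ≤ infDist z D := by
      by_contra! hlt
      exact (nonpos_of_mem_freeBoundary hu hzF).not_gt (hpos z hzF.1.1 hlt)
    have hδd : δ ≤ 2 * d := by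
      have htri := infDist_le_infDist_add_dist (s := D) (x := z) (y := x)
      rw [dist_comm, ← hxz] at htri
      linarith
    calc u x ≤ M := huM x hx.1
      _ ≤ 2 * M / δ * d := by
        rw [div_mul_eq_mul_div, le_div_iff₀ hδ]
        nlinarith
      _ ≤ (c + 2 * M / δ) * d := by
        gcongr
        exact le_add_of_nonneg_left hc

lemma IsOnePhaseHarmonic.norm_fderiv_le (hu : IsOnePhaseHarmonic D u) (hD : IsOpen D)
    (hx : x ∈ posSet D u) (hd : 0 < d) (hdD : d ≤ infDist x D)
    (hdF : d ≤ infDist x (freeBoundary D u)) : ‖fderiv ℝ u x‖ ≤ 8 * u x / d := by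
  have hpos : ball x d ⊆ posSet D u :=
    ball_subset_posSet hD hu.lowerSemicontinuousOn hx hd hdD hdF
  exact norm_fderiv_le_of_harmonic (fun z hz => hu.harmonicAt z
    (notMem_closure_of_infDist_pos (infDist_pos_of_mem_ball hdD hz)) (hpos hz).2)
    (fun z hz => (hpos hz).2.le) hd

lemma HasLinearGrowth.norm_fderiv_le (hgrow : HasLinearGrowth D c u)
    (hu : IsOnePhaseHarmonic D u) (hD : IsOpen D) (hne : (freeBoundary D u).Nonempty)
    (hx : x ∈ posSet D u) (hFD : infDist x (freeBoundary D u) ≤ infDist x D) :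
    ‖fderiv ℝ u x‖ ≤ 8 * c := by
  have hd := infDist_freeBoundary_pos hD hu.lowerSemicontinuousOn hne hx
  refine (hu.norm_fderiv_le hD hx hd hFD le_rfl).trans ?_
  rw [div_le_iff₀ hd]
  linarith [hgrow x hx hFD]

lemma eventuallyEq_zero_of_notMem_closure (hnn : ∀ y ∉ D, 0 ≤ u y) (hxD : x ∉ closure D)
    (hx : x ∉ closure (posSet D u)) : u =ᶠ[𝓝 x] 0 := by
  filter_upwards [eventually_notMem_of_notMem_closure hxD, eventually_notMem_of_notMem_closure hx]
    with y hyD hy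
  exact (hnn y hyD).antisymm' (not_lt.1 fun hpos => hy ⟨hyD, hpos⟩)

lemma HasLinearGrowth.continuousAt_of_mem_freeBoundary (hgrow : HasLinearGrowth D c u)
    (hc : 0 ≤ c) (hnn : ∀ y ∉ D, 0 ≤ u y) (hxD : 0 < infDist x D) (hxF : x ∈ freeBoundary D u)
    (hx : u x = 0) : ContinuousAt u x := by
  have hlim : Tendsto (fun y => c * dist y x) (𝓝 x) (𝓝 0) := by
    have hcont : Continuous fun y => c * dist y x := by fun_prop
    simpa using hcont.tendsto x
  have hnear : ∀ᶠ y in 𝓝 x, y ∉ D :=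
    eventually_notMem_of_notMem_closure (notMem_closure_of_infDist_pos hxD)
  rw [ContinuousAt, hx]
  refine tendsto_of_tendsto_of_tendsto_of_le_of_le' tendsto_const_nhds hlim
    (hnear.mono hnn) ?_
  filter_upwards [hnear, ball_mem_nhds x (half_pos hxD)] with y hyD hyx
  rcases (hnn y hyD).eq_or_lt with hy | hy
  · rw [← hy]
    positivity
  · have hyF : infDist y (freeBoundary D u) ≤ dist y x := infDist_le_dist_of_mem hxF
    have htri := infDist_le_infDist_add_dist (s := D) (x := x) (y := y)
    rw [mem_ball'] at hyx
    rw [dist_comm y x] at hyF ⊢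
    exact (hgrow y ⟨hyD, hy⟩ (by linarith)).trans (by gcongr)

lemma HasLinearGrowth.continuousAt (hgrow : HasLinearGrowth D c u) (hc : 0 ≤ c)
    (hu : IsOnePhaseHarmonic D u) (hx : 0 < infDist x D) : ContinuousAt u x := by
  have hxcl : x ∉ closure D := notMem_closure_of_infDist_pos hx
  have hxD : x ∉ D := fun h => hxcl (subset_closure h)
  rcases (hu.nonneg x hxD).eq_or_lt with hzero | hpos
  · by_cases hcl : x ∈ closure (posSet D u)
    · exact hgrow.continuousAt_of_mem_freeBoundary hc hu.nonneg hx
        (mem_freeBoundary_of_nonpos hxD hzero.ge hcl) hzero.symm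
    · exact (eventuallyEq_zero_of_notMem_closure hu.nonneg hxcl hcl).continuousAt
  · exact (hu.harmonicAt x hxcl hpos).1.continuousAt

end LinearGrowth

section Lipschitz

variable {D : Set Plane} {u : Plane → ℝ} {x y : Plane} {c δ G L : ℝ}

/-- The derivative bound is only needed after the last time `φ` is at most `φ 0`. -/
lemma le_add_of_deriv_le_of_pos {φ : ℝ → ℝ} (hL : 0 ≤ L) (hc : ContinuousOn φ (Icc 0 1))
    (h0 : 0 ≤ φ 0) (hdiff : ∀ t ∈ Ioo (0 : ℝ) 1, 0 < φ t → DifferentiableAt ℝ φ t)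
    (hderiv : ∀ t ∈ Ioo (0 : ℝ) 1, 0 < φ t → deriv φ t ≤ L) : φ 1 ≤ φ 0 + L := by
  have hcompact : IsCompact (Icc (0 : ℝ) 1 ∩ φ ⁻¹' Iic (φ 0)) :=
    isCompact_Icc.of_isClosed_subset (hc.preimage_isClosed_of_isClosed isClosed_Icc isClosed_Iic)
      inter_subset_left
  obtain ⟨s, ⟨⟨hs0, hs1⟩, hφs⟩, hlast⟩ := hcompact.exists_isGreatest ⟨0, by simp⟩
  rw [mem_preimage, mem_Iic] at hφs
  rcases hs1.eq_or_lt with rfl | hlt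
  · linarith
  have hpos : ∀ t ∈ Ioo s 1, 0 < φ t := fun t ht => by
    by_contra! hle
    exact ht.1.not_ge (hlast ⟨⟨hs0.trans ht.1.le, ht.2.le⟩, hle.trans h0⟩)
  have hmem : ∀ t ∈ Ioo s 1, t ∈ Ioo (0 : ℝ) 1 := fun t ht => ⟨hs0.trans_lt ht.1, ht.2⟩
  obtain ⟨t, ht, hslope⟩ := exists_deriv_eq_slope φ hlt (hc.mono (Icc_subset_Icc_left hs0))
    fun t ht => (hdiff t (hmem t ht) (hpos t ht)).differentiableWithinAt
  have hle := hderiv t (hmem t ht) (hpos t ht)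
  rw [hslope, div_le_iff₀ (sub_pos.2 hlt)] at hle
  nlinarith

lemma le_add_mul_dist_of_norm_fderiv_le {E : Type*} [NormedAddCommGroup E] [NormedSpace ℝ E]
    {u : E → ℝ} {x y : E} (hL : 0 ≤ L) (hy : 0 ≤ u y)
    (hc : ∀ z ∈ segment ℝ y x, ContinuousAt u z)
    (hdiff : ∀ z ∈ segment ℝ y x, 0 < u z → DifferentiableAt ℝ u z)
    (hderiv : ∀ z ∈ segment ℝ y x, 0 < u z → ‖fderiv ℝ u z‖ ≤ L) :
    u x ≤ u y + L * dist x y := by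
  set γ : ℝ → E := fun t => AffineMap.lineMap y x t
  have hγ : ∀ t, HasDerivAt γ (x - y) t := fun _ => AffineMap.hasDerivAt_lineMap
  have hmem : ∀ t ∈ Icc (0 : ℝ) 1, γ t ∈ segment ℝ y x := fun t ht => by
    rw [segment_eq_image_lineMap]
    exact mem_image_of_mem γ ht
  have hchain : ∀ t ∈ Ioo (0 : ℝ) 1, 0 < u (γ t) →
      HasDerivAt (u ∘ γ) (fderiv ℝ u (γ t) (x - y)) t := fun t ht hpos =>
    (hdiff _ (hmem t (Ioo_subset_Icc_self ht)) hpos).hasFDerivAt.comp_hasDerivAt t (hγ t)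
  have hle := le_add_of_deriv_le_of_pos (φ := u ∘ γ) (mul_nonneg hL (dist_nonneg (x := x) (y := y)))
    (fun t ht => ((hc _ (hmem t ht)).comp (hγ t).continuousAt).continuousWithinAt)
    (by simpa [γ] using hy) (fun t ht hpos => (hchain t ht hpos).differentiableAt)
    fun t ht hpos => ?_
  · simpa [γ] using hle
  · rw [(hchain t ht hpos).deriv, dist_eq_norm]
    exact (le_abs_self _).trans (((fderiv ℝ u (γ t)).le_opNorm (x - y)).trans
      (mul_le_mul_of_nonneg_right (hderiv _ (hmem t (Ioo_subset_Icc_self ht)) hpos)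
        (norm_nonneg _)))

lemma HasLinearGrowth.norm_fderiv_le_of_le_infDist (hgrow : HasLinearGrowth D c u)
    (hu : IsOnePhaseHarmonic D u) (hD : IsOpen D) (hne : (freeBoundary D u).Nonempty)
    (hcL : 8 * c ≤ L) (hGL : 8 * G ≤ L * δ) (huG : ∀ y ∉ D, u y ≤ G) (hδ : 0 < δ)
    (hx : x ∈ posSet D u) (hxD : δ ≤ infDist x D) : ‖fderiv ℝ u x‖ ≤ L := by
  rcases le_or_gt (infDist x (freeBoundary D u)) (infDist x D) with hFD | hFD
  · exact (hgrow.norm_fderiv_le hu hD hne hx hFD).trans hcL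
  · refine (hu.norm_fderiv_le hD hx hδ hxD (hxD.trans hFD.le)).trans ?_
    rw [div_le_iff₀ hδ]
    linarith [huG x hx.1]

lemma half_le_infDist_of_mem_segment {z : Plane} (hx : δ ≤ infDist x D) (hy : δ ≤ infDist y D)
    (hxy : dist x y ≤ δ) (hz : z ∈ segment ℝ y x) : δ / 2 ≤ infDist z D := by
  have hsum := dist_add_dist_of_mem_segment hz
  have htrix := infDist_le_infDist_add_dist (s := D) (x := x) (y := z)
  have htriy := infDist_le_infDist_add_dist (s := D) (x := y) (y := z)
  rw [dist_comm x z] at htrix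
  rw [dist_comm y x] at hsum
  linarith

lemma HasLinearGrowth.lipschitzOnWith (hgrow : HasLinearGrowth D c u)
    (hu : IsOnePhaseHarmonic D u) (hD : IsOpen D) (hne : (freeBoundary D u).Nonempty)
    (hc : 0 ≤ c) (hcL : 8 * c ≤ L) (hGL : 16 * G ≤ L * δ) (huG : ∀ y ∉ D, u y ≤ G)
    (hδ : 0 < δ) : LipschitzOnWith L.toNNReal u {x | δ ≤ infDist x D} := by
  have hL : 0 ≤ L := by linarith
  have hout : ∀ {x}, 0 < infDist x D → x ∉ D := fun hx hxD =>
    notMem_closure_of_infDist_pos hx (subset_closure hxD)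
  refine LipschitzOnWith.of_le_add_mul _ fun x hx y hy => ?_
  rw [mem_ofPred_eq] at hx hy
  rw [Real.coe_toNNReal _ hL]
  have hxD : x ∉ D := hout (hδ.trans_le hx)
  have hyD : y ∉ D := hout (hδ.trans_le hy)
  rcases le_or_gt δ (dist x y) with hfar | hnear
  · have : 0 ≤ L * (dist x y - δ) := mul_nonneg hL (sub_nonneg.2 hfar)
    linarith [huG x hxD, hu.nonneg x hxD, hu.nonneg y hyD]
  · have hseg : ∀ z ∈ segment ℝ y x, δ / 2 ≤ infDist z D := fun z =>
      half_le_infDist_of_mem_segment hx hy hnear.le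
    have hseg_pos : ∀ z ∈ segment ℝ y x, 0 < infDist z D := fun z hz =>
      (half_pos hδ).trans_le (hseg z hz)
    refine le_add_mul_dist_of_norm_fderiv_le hL (hu.nonneg y hyD)
      (fun z hz => hgrow.continuousAt hc hu (hseg_pos z hz))
      (fun z hz hpos => (hu.harmonicAt z (notMem_closure_of_infDist_pos (hseg_pos z hz))
        hpos).1.differentiableAt two_ne_zero)
      fun z hz hpos => hgrow.norm_fderiv_le_of_le_infDist hu hD hne hcL (by linarith) huG
        (half_pos hδ) ⟨hout (hseg_pos z hz), hpos⟩ (hseg z hz)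

end Lipschitz

section Growth

variable {D : Set Plane} {f g h W : Plane → ℝ} {c x : Plane} {d m κ ρ σ R : ℝ}

lemma eventually_harmonicOnNhd_closedBall (hd : 0 ≤ d) (hh : HarmonicOnNhd h (closedBall x d)) :
    ∀ᶠ R in 𝓝[>] d, HarmonicOnNhd h (closedBall x R) := by
  obtain ⟨ε, hε, hsub⟩ := (isCompact_closedBall x d).exists_cthickening_subset_open
    (isOpen_setOfPred_harmonicAt h) hh
  rw [cthickening_closedBall hε.le hd] at hsub
  filter_upwards [Ioo_mem_nhdsGT (lt_add_of_pos_left d hε)] with R hR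
  exact fun y hy => hsub (closedBall_subset_closedBall hR.2.le hy)

lemma eventually_mul_log_div_lt (hd : 0 < d) (hm : 0 < m) :
    ∀ᶠ R in 𝓝[>] d, κ * Real.log (R / d) < m := by
  have hcont : ContinuousAt (fun R => κ * Real.log (R / d)) d :=
    continuousAt_const.mul ((continuousAt_id.div_const d).log (by simp [hd.ne']))
  refine nhdsWithin_le_nhds (hcont.eventually (gt_mem_nhds ?_))
  simpa [hd.ne'] using hm

lemma ball_diff_subset_posSet_largestSubsolution (hD : IsOpen D) (hW : Admissible D f g h W)
    (hWpos : ∀ x ∈ frontier D, 0 < W x) (hh₀ : ∀ x, 0 ≤ h x) (hκ : 0 < κ) (hρ : 0 < ρ)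
    (hρR : ρ < R) (hball : closedBall c ρ ⊆ (closure D)ᶜ)
    (hbig : ∀ x ∈ closedBall c ρ, κ * Real.log (R / ρ) < largestSubsolution D f g h x)
    (hbd : ∀ x ∈ frontier D, κ * Real.log (R / dist x c) ≤ g x)
    (hh : HarmonicOnNhd h (closedBall c R)) (hf : ∀ x ∈ sphere c R, √(f x) ≤ κ / R) :
    ball c R \ D ⊆ posSet D (largestSubsolution D f g h) := by
  obtain ⟨v, hv, hvbig⟩ := exists_admissible_lt_of_isCompact hW (isCompact_closedBall c ρ)
    (hball.trans (compl_subset_compl.2 subset_closure)) hbig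
  have hw := (hv.sup hW).sup_truncatedLog hD hκ hρ hρR hball
    (fun x hx => (hvbig x hx).le.trans (le_max_left _ _)) hbd
    (fun x hx => lt_max_of_lt_right (hWpos x hx)) hh₀ hh hf
  exact fun x hx => ⟨hx.2, (lt_max_of_lt_right (truncatedLog_pos hκ hρ hρR hx.1)).trans_le
    (hw.le_largestSubsolution hx.2)⟩

/-- If `u` were large compared with `d` at `x`, then by Harnack's inequality a logarithm that is
positive in `B_R(x)`, `R > d`, and has slope at least `σ` on `∂B_R(x)` would lie below `u`. -/
lemma closedBall_diff_subset_posSet_of_lt (hD : IsOpen D) (hh : IsUpperBarrier D h)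
    (hW : Admissible D f g h W) (hWpos : ∀ y ∈ frontier D, 0 < W y) (hm : 0 < m)
    (hg : ∀ y ∈ frontier D, m ≤ g y) (hf : ∀ y, √(f y) ≤ σ) (hd : 0 < d) (hdD : d ≤ infDist x D)
    (hdF : d ≤ infDist x (freeBoundary D (largestSubsolution D f g h)))
    (hx : x ∈ posSet D (largestSubsolution D f g h)) (hhd : HarmonicOnNhd h (closedBall x d))
    (hlt : 40 * σ * d < largestSubsolution D f g h x) :
    closedBall x d \ D ⊆ posSet D (largestSubsolution D f g h) := by
  set u := largestSubsolution D f g h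
  have hσ : 0 ≤ σ := (Real.sqrt_nonneg _).trans (hf x)
  have hux : 0 < u x := hx.2
  have hupos : ball x d ⊆ posSet D u :=
    ball_subset_posSet hD (lowerSemicontinuousOn_largestSubsolution hW) hx hd hdD hdF
  have hcl : ∀ y ∈ ball x d, y ∉ closure D := fun y hy =>
    notMem_closure_of_infDist_pos (infDist_pos_of_mem_ball hdD hy)
  have hharm : HarmonicOnNhd u (ball x d) := fun y hy =>
    harmonicAt_largestSubsolution hh hW (hcl y hy) (hupos hy).2
  have hhalf : closedBall x (d / 2) ⊆ ball x d := closedBall_subset_ball (half_lt_self hd)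
  obtain ⟨R, ⟨hhR, hmR⟩, hdR, hRd⟩ :=
    (((eventually_harmonicOnNhd_closedBall hd.le hhd).and
      (eventually_mul_log_div_lt (κ := u x / 20) hd hm)).and
      (Ioo_mem_nhdsGT (by linarith : d < 2 * d))).exists
  have hR : 0 < R := hd.trans hdR
  have hlog : Real.log (R / (d / 2)) ≤ 3 := by
    have hquot : R / (d / 2) ≤ 4 := by
      rw [div_le_iff₀ (half_pos hd)]
      linarith
    linarith [Real.log_le_sub_one_of_pos (div_pos hR (half_pos hd))]
  refine (sdiff_subset_sdiff_left (closedBall_subset_ball hdR)).trans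
    (ball_diff_subset_posSet_largestSubsolution hD hW hWpos hh.nonneg (κ := u x / 20)
      (by positivity) (half_pos hd) (by linarith) (fun y hy => hcl y (hhalf hy))
      (fun y hy => ?_) (fun y hy => ?_) hhR fun y _ => (hf y).trans ?_)
  · have hharnack : u x / 5 ≤ u y := div_five_le_of_harmonic hharm
      (fun z hz => (hupos hz).2.le) hd hy
    nlinarith
  · have hyd : d ≤ dist y x := not_lt.1 fun hlt => hcl y hlt hy.1
    have : 0 < R / dist y x := div_pos hR (hd.trans_le hyd)
    refine le_trans ?_ (hmR.le.trans (hg y hy))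
    gcongr
  · rw [le_div_iff₀ hR]
    nlinarith

lemma harmonicOnNhd_logSupersolution_closedBall {lam r G : ℝ} {p : Plane} (hlam : 0 < lam)
    (hr : 0 < r) (hG : 0 < G) (hp : p ∉ closedBall x d) (hlt : dist x p + d < outerRadius lam r G) :
    HarmonicOnNhd (logSupersolution lam p r G) (closedBall x d) := fun z hz =>
  harmonicAt_logSupersolution hlam hr hG (ne_of_mem_of_not_mem hz hp) (by
    linarith [dist_triangle z x p, mem_closedBall.1 hz])

lemma disjoint_closedBall_of_le_infDist (hD : IsOpen D) (hd : 0 < d) (hdD : d ≤ infDist x D) :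
    Disjoint (closedBall x d) D := by
  rw [← closure_ball x hd.ne']
  exact (disjoint_ball_infDist.mono_left (ball_subset_ball hdD)).closure_left hD

lemma hasLinearGrowth_largestSubsolution {lam Lam r G : ℝ} {p : Plane} (hD : IsOpen D)
    (hlam : 0 < lam) (hLam : lam ≤ Lam) (hr : 0 < r) (hG : 0 < G) (hp : p ∈ D)
    (hW : Admissible D f g (logSupersolution lam p r G) W) (hWpos : ∀ y ∈ frontier D, 0 < W y)
    (hm : 0 < m) (hg : ∀ y ∈ frontier D, m ≤ g y) (hf : ∀ y, f y ≤ Lam)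
    (hne : (freeBoundary D (largestSubsolution D f g (logSupersolution lam p r G))).Nonempty) :
    HasLinearGrowth D (40 * √Lam) (largestSubsolution D f g (logSupersolution lam p r G)) := by
  intro x hx hFD
  set u := largestSubsolution D f g (logSupersolution lam p r G)
  have hlsc : LowerSemicontinuousOn u Dᶜ := lowerSemicontinuousOn_largestSubsolution hW
  set d := infDist x (freeBoundary D u)
  obtain ⟨y, hyF, hxy⟩ := (isClosed_freeBoundary hD).exists_infDist_eq_dist hne x
  have hd : 0 < d := infDist_freeBoundary_pos hD hlsc hne hx
  have hpx : d ≤ dist x p := hFD.trans (infDist_le_dist_of_mem hp)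
  by_contra! hlt
  rcases le_or_gt (outerRadius lam r G) (dist x p + d) with hR | hR
  · have hux : u x ≤ 2 * √lam * d := (largestSubsolution_le hW hx.1).trans
      (logSupersolution_le_of_near hlam hr hG hd hpx hR)
    have : √lam * d ≤ √Lam * d := by gcongr
    nlinarith [Real.sqrt_nonneg Lam]
  · have hharm : HarmonicOnNhd (logSupersolution lam p r G) (closedBall x d) :=
      harmonicOnNhd_logSupersolution_closedBall hlam hr hG
        (disjoint_right.1 (disjoint_closedBall_of_le_infDist hD hd hFD) hp) hR
    have hypos := closedBall_diff_subset_posSet_of_lt hD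
      (isUpperBarrier_logSupersolution hlam hr hG hp) hW hWpos hm hg
      (fun z => Real.sqrt_le_sqrt (hf z)) hd hFD le_rfl hx hharm hlt
      ⟨mem_closedBall'.2 hxy.ge, hyF.1.1⟩
    exact hypos.2.not_ge (nonpos_of_mem_freeBoundary hlsc hyF)

end Growth

section RegularityAndGrowth

variable {D : Set Plane} {f g h v₀ : Plane → ℝ} {lam Lam m : ℝ}

lemma isBounded_posSet_largestSubsolution (hh : IsUpperBarrier D h) (h₀ : Admissible D f g h v₀) :
    Bornology.IsBounded (posSet D (largestSubsolution D f g h)) := by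
  obtain ⟨c, R, hzero⟩ := hh.support
  refine isBounded_ball.subset (t := ball c R) fun x hx => ?_
  by_contra hxR
  exact hx.2.not_ge ((largestSubsolution_le h₀ hx.1).trans (hzero x (not_lt.1 hxR)).le)

lemma frontier_nonempty_of_isBounded (hb : Bornology.IsBounded D) (hne : D.Nonempty) :
    (frontier D).Nonempty :=
  nonempty_frontier_iff.2 ⟨hne, fun huniv => NormedSpace.unbounded_univ ℝ Plane (huniv ▸ hb)⟩

lemma exists_admissible_logSupersolution (hD : IsOpen D) (hc : IsConnected D)
    (hb : Bornology.IsBounded D) (hlam : 0 < lam) (hLam : 0 < Lam) (hm : 0 < m) :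
    ∃ δ > 0, ∃ W : Plane → ℝ, (∀ x ∉ D, infDist x D < δ → 0 < W x) ∧
      ∀ {f g : Plane → ℝ} {p : Plane} {r G : ℝ}, (∀ x, f x ≤ Lam) →
        (∀ x ∈ frontier D, m ≤ g x) → p ∈ D → D ⊆ ball p r → (∀ x ∈ frontier D, g x ≤ G) →
        Admissible D f g (logSupersolution lam p r G) W := by
  obtain ⟨a, ha⟩ := hc.nonempty
  obtain ⟨y, hy, z, hz, hyz⟩ := (infinite_of_mem_nhds a (hD.mem_nhds ha)).nontrivial
  have hyz' : 0 < dist y z := dist_pos.2 hyz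
  set t := min (dist y z / 8) (m / (4 * √lam))
  have ht : 0 < t := by positivity
  have htm : t * (4 * √lam) ≤ m := (le_div_iff₀ (by positivity)).1 (min_le_right _ _)
  obtain ⟨δ, hδ, W, hW, hWpos⟩ := exists_isLowerBarrier hD hc hb (half_pos hm) hLam ht
  refine ⟨δ, hδ, W, hWpos, fun {f g p r G} hf hg hp hDr hgG => ?_⟩
  obtain ⟨b, hbD⟩ := frontier_nonempty_of_isBounded hb hc.nonempty
  have hmG : m ≤ G := (hg b hbD).trans (hgG b hbD)
  have hyzr : dist y z ≤ r + r := (dist_triangle_right y z p).trans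
    (add_le_add (hDr hy).le (hDr hz).le)
  have htr : t ≤ r / 4 := (min_le_left _ _).trans (by linarith)
  refine hW.admissible hδ hWpos hD (fun x hx => (half_le_self hm.le).trans (hg x hx)) hf
    (fun _ => le_max_right _ _) fun x hxD hx => ?_
  obtain ⟨y, hy, hxy⟩ := (infDist_lt_iff hc.nonempty).1 hx
  refine le_trans (by linarith) (le_logSupersolution_of_near hlam (by linarith) (by linarith)
    ht.le htr (by linarith) (fun hxp => hxD (hxp ▸ hp)) ?_)
  linarith [dist_triangle x y p, mem_ball.1 (hDr hy)]

lemma forall_mem_frontier_of_infDist_lt {P : Plane → Prop} {δ : ℝ} (hD : IsOpen D) (hδ : 0 < δ)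
    (hP : ∀ x ∉ D, infDist x D < δ → P x) : ∀ x ∈ frontier D, P x := fun x hx =>
  hP x (disjoint_left.1 (disjoint_frontier_iff_isOpen.2 hD) hx)
    (by rwa [infDist_zero_of_mem_closure hx.1])

lemma exists_bounds_of_continuousOn_frontier (hb : Bornology.IsBounded D) (hne : D.Nonempty)
    (hgc : ContinuousOn g (frontier D)) (hg : ∀ x ∈ frontier D, 0 < g x) :
    ∃ m M : ℝ, 0 < m ∧ m ≤ M ∧ ∀ x ∈ frontier D, g x ∈ Icc m M := by
  have hcompact : IsCompact (frontier D) :=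
    hb.isCompact_closure.of_isClosed_subset isClosed_frontier frontier_subset_closure
  have hfne := frontier_nonempty_of_isBounded hb hne
  obtain ⟨y, hy, hmin⟩ := hcompact.exists_isMinOn hfne hgc
  obtain ⟨z, hz, hmax⟩ := hcompact.exists_isMaxOn hfne hgc
  exact ⟨g y, g z, hg y hy, hmin hz, fun x hx => ⟨hmin hx, hmax hx⟩⟩

lemma exists_regularity_largestSubsolution (hD : IsOpen D) (hc : IsConnected D)
    (hb : Bornology.IsBounded D) (hlam : 0 < lam) (hLam : lam ≤ Lam) (hm : 0 < m) :
    ∃ δ > 0, ∀ {f g : Plane → ℝ} {p : Plane} {r G : ℝ} {u : Plane → ℝ}, (∀ x, f x ≤ Lam) →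
      (∀ x ∈ frontier D, m ≤ g x) → p ∈ D → D ⊆ ball p r → (∀ x ∈ frontier D, g x ≤ G) →
      u = largestSubsolution D f g (logSupersolution lam p r G) →
      IsOnePhaseHarmonic D u ∧ (freeBoundary D u).Nonempty ∧ HasLinearGrowth D (40 * √Lam) u ∧
        (∀ x ∉ D, infDist x D < δ → 0 < u x) ∧
        ∀ M, 0 ≤ M → (∀ x ∈ frontier D, g x ≤ M) → ∀ x ∉ D, u x ≤ M := by
  obtain ⟨δ, hδ, W, hWpos, hWadm⟩ :=
    exists_admissible_logSupersolution hD hc hb hlam (hlam.trans_le hLam) hm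
  refine ⟨δ, hδ, fun {f g p r G u} hf hg hp hDr hgG hu => ?_⟩
  subst hu
  obtain ⟨y, hy⟩ := frontier_nonempty_of_isBounded hb hc.nonempty
  have hG : 0 < G := hm.trans_le ((hg y hy).trans (hgG y hy))
  have hr : 0 < r := dist_nonneg.trans_lt (hDr hp)
  have hh : IsUpperBarrier D (logSupersolution lam p r G) :=
    isUpperBarrier_logSupersolution hlam hr hG hp
  have hW := hWadm hf hg hp hDr hgG
  have hpos : ∀ x ∉ D, infDist x D < δ →
      0 < largestSubsolution D f g (logSupersolution lam p r G) x := fun x hxD hx =>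
    (hWpos x hxD hx).trans_le (hW.le_largestSubsolution hxD)
  have hharm := isOnePhaseHarmonic_largestSubsolution hh hW
  have hne := freeBoundary_nonempty hD hb hc.nonempty hharm.lowerSemicontinuousOn
    (forall_mem_frontier_of_infDist_lt hD hδ hpos) (isBounded_posSet_largestSubsolution hh hW)
  exact ⟨hharm, hne, hasLinearGrowth_largestSubsolution hD hlam hLam hr hG hp hW
    (forall_mem_frontier_of_infDist_lt hD hδ hWpos) hm hg hf hne, hpos,
    fun _ hM hgM _ => largestSubsolution_le_of_boundary_le hD hh hW hM hgM⟩

end RegularityAndGrowth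

end OnePhase

end

open OnePhase in
theorem theorem3p1_general :
    ∃ C : ℝ, 0 < C ∧
      ∀ (D : Set Plane) (lam Lam m M : ℝ), IsOpen D → IsConnected D → Bornology.IsBounded D →
        0 < lam → lam ≤ Lam → 0 < m → m ≤ M →
        ∃ K : ℝ, 0 < K ∧
          ∀ (f g : Plane → ℝ) (p : Plane) (r G : ℝ) (u : Plane → ℝ),
            (∀ x, f x ∈ Icc 0 Lam) → (∀ x ∈ frontier D, g x ∈ Icc m M) →
            p ∈ D → D ⊆ ball p r → (∀ x ∈ frontier D, g x ≤ G) →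
            u = largestSubsolution D f g (logSupersolution lam p r G) →
            (∀ x ∈ posSet D u, u x ≤ K * infDist x (freeBoundary D u)) ∧
            (∀ x ∈ posSet D u, infDist x (freeBoundary D u) ≤ infDist x D →
              u x ≤ C * √Lam * infDist x (freeBoundary D u)) ∧
            (∀ x ∈ posSet D u, x ∉ closure D → DifferentiableAt ℝ u x ∧
              (infDist x (freeBoundary D u) ≤ infDist x D → ‖fderiv ℝ u x‖ ≤ C * √Lam)) ∧
            (∀ δ : ℝ, 0 < δ →
              LipschitzOnWith (Real.toNNReal (C * max (√Lam) (G / δ))) u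
                {x | δ ≤ infDist x D}) := by
  refine ⟨320, by norm_num, fun D lam Lam m M hD hc hb hlam hLam hm hmM => ?_⟩
  obtain ⟨δ₀, hδ₀, hreg⟩ := exists_regularity_largestSubsolution hD hc hb hlam hLam hm
  have hM : 0 < M := hm.trans_le hmM
  refine ⟨40 * √Lam + 2 * M / δ₀, by positivity, fun f g p r G u hf hg hp hDr hgG hu => ?_⟩
  obtain ⟨hharm, hne, hgrow, hpos, hle⟩ :=
    hreg (fun x => (hf x).2) (fun x hx => (hg x hx).1) hp hDr hgG hu
  obtain ⟨y, hy⟩ := frontier_nonempty_of_isBounded hb hc.nonempty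
  have hG : 0 ≤ G := hm.le.trans ((hg y hy).1.trans (hgG y hy))
  have hc₀ : 0 ≤ 40 * √Lam := by positivity
  refine ⟨fun x => hgrow.le_mul_infDist hD hharm.lowerSemicontinuousOn hne hc₀ hM.le
      (hle M hM.le fun x hx => (hg x hx).2) hδ₀ hpos,
    fun x hx hFD => (hgrow x hx hFD).trans ?_,
    fun x hx hxD => ⟨(hharm.harmonicAt x hxD hx.2).1.differentiableAt two_ne_zero, fun hFD =>
      (hgrow.norm_fderiv_le hharm hD hne hx hFD).trans_eq (by ring)⟩,
    fun δ hδ => hgrow.lipschitzOnWith hharm hD hne hc₀ ?_ ?_ (hle G hG hgG) hδ⟩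
  · gcongr
    · exact infDist_nonneg
    · norm_num
  · linarith [le_max_left (√Lam) (G / δ)]
  · linarith [(div_le_iff₀ hδ).1 (le_max_right (√Lam) (G / δ))]

theorem theorem3p1 :
    ∃ C : ℝ, 0 < C ∧
      ∀ (D : Set OnePhase.Plane) (g : OnePhase.Plane → ℝ) (lam Lam : ℝ),
        IsOpen D → IsConnected D → Bornology.IsBounded D →
        ContinuousOn g (frontier D) → (∀ x ∈ frontier D, 0 < g x) → 0 < lam →
        ∃ K : ℝ, 0 < K ∧
          ∀ (f : OnePhase.Plane → ℝ) (p : OnePhase.Plane) (r G : ℝ) (u : OnePhase.Plane → ℝ),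
            Continuous f → (∀ x, lam < f x ∧ f x < Lam) →
            p ∈ D → D ⊆ Metric.ball p r → (∀ x ∈ frontier D, g x ≤ G) →
            u = OnePhase.largestSubsolution D f g (OnePhase.logSupersolution lam p r G) →
            (∀ x ∈ OnePhase.posSet D u,
              u x ≤ K * Metric.infDist x (OnePhase.freeBoundary D u)) ∧
            (∀ x ∈ OnePhase.posSet D u,
              Metric.infDist x (OnePhase.freeBoundary D u) ≤ Metric.infDist x D →
              u x ≤ C * √Lam * Metric.infDist x (OnePhase.freeBoundary D u)) ∧
            (∀ x ∈ OnePhase.posSet D u, x ∉ closure D → DifferentiableAt ℝ u x ∧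
              (Metric.infDist x (OnePhase.freeBoundary D u) ≤ Metric.infDist x D →
                ‖fderiv ℝ u x‖ ≤ C * √Lam)) ∧
            (∀ δ : ℝ, 0 < δ →
              LipschitzOnWith (Real.toNNReal (C * max (√Lam) (G / δ))) u
                {x | δ ≤ Metric.infDist x D}) := by
  obtain ⟨C, hC, hgen⟩ := theorem3p1_general
  refine ⟨C, hC, fun D g lam Lam hD hc hb hgc hg hlam => ?_⟩
  obtain ⟨m, M, hm, hmM, hgmM⟩ :=
    OnePhase.exists_bounds_of_continuousOn_frontier hb hc.nonempty hgc hg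
  obtain ⟨K, hK, h⟩ := hgen D lam (max lam Lam) m M hD hc hb hlam (le_max_left _ _) hm hmM
  refine ⟨K, hK, fun f p r G u _ hf hp hDr hgG hu => ?_⟩
  have hLam : max lam Lam = Lam := max_eq_right ((hf p).1.trans (hf p).2).le
  rw [hLam] at h
  exact h f g p r G u (fun x => ⟨(hlam.trans (hf x).1).le, (hf x).2.le⟩) hgmM hp hDr hgG hu
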